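/- Let $r>0$, let $B=B(O,r)\subset\mathbb{R}^2$ be the open ball of radius $r$ centred at the origin $O$, with standard coordinates $(x,y)$, and let $g$ be a $C^\infty$ Riemannian metric on $B$ whose Gauss curvature is positive on $B\setminus\{O\}$. Let $X:(B,g)\to(\mathbb{R}^3,g_{can})$ be an isometric embedding of class $C^{1,1}$ (differentiable with locally Lipschitz derivative on $B$) into flat three-space, of the form $$X(x,y)=(x,y,u(x,y)),\qquad u(O)=0,\quad u_x(O)=u_y(O)=0.$$ Assume that there is a constant $C_0>0$ such that $\Delta u=u_{xx}+u_{yy}>C_0$ at every point of some punctured neighbourhood of $O$ (nothing is assumed about $\Delta u$ at $O$ itself). Then $X\in C^\infty(B)$; in particular $X$ is $C^\infty$ near $O$. -/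

import Mathlib

open scoped ContDiff

noncomputable section

/-- The Euclidean plane with its standard coordinates `x = p 0`, `y = p 1`. -/
abbrev Plane := EuclideanSpace ℝ (Fin 2)

/-- Euclidean three-space; its inner product is the canonical flat metric. -/
abbrev Space := EuclideanSpace ℝ (Fin 3)

/-- The partial derivative of a real function on the plane in the `i`-th coordinate direction. -/
def partialD (i : Fin 2) (f : Plane → ℝ) (p : Plane) : ℝ :=
  fderiv ℝ f p (EuclideanSpace.single i 1)

/-- `g`, given by its matrix of components in the standard coordinates, is a `C^n` Riemannian
metric on `U`. -/
structure IsRiemannianMetricOn (n : WithTop ℕ∞) (g : Plane → Matrix (Fin 2) (Fin 2) ℝ)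
    (U : Set Plane) : Prop where
  contDiffOn : ∀ i j, ContDiffOn ℝ n (fun p => g p i j) U
  posDef : ∀ p ∈ U, (g p).PosDef

/-- The Christoffel symbol
`Γ^k_{ij} = (1/2) ∑_l g^{kl} (∂_i g_{jl} + ∂_j g_{il} - ∂_l g_{ij})`. -/
def christoffel (g : Plane → Matrix (Fin 2) (Fin 2) ℝ) (k i j : Fin 2) (p : Plane) : ℝ :=
  (1 / 2) * ∑ l, (g p)⁻¹ k l *
    (partialD i (fun q => g q j l) p + partialD j (fun q => g q i l) p
      - partialD l (fun q => g q i j) p)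

/-- The component `R^l_{kij}` of the Riemann curvature tensor, where
`R(∂_i, ∂_j) ∂_k = ∑_l R^l_{kij} ∂_l` and `R(V, W) = [∇_V, ∇_W] - ∇_[V, W]`. -/
def riemannCurvature (g : Plane → Matrix (Fin 2) (Fin 2) ℝ) (l k i j : Fin 2) (p : Plane) : ℝ :=
  partialD i (christoffel g l j k) p - partialD j (christoffel g l i k) p
    + ∑ m, (christoffel g l i m p * christoffel g m j k p
      - christoffel g l j m p * christoffel g m i k p)

/-- The Gauss curvature `g(R(∂_0, ∂_1) ∂_1, ∂_0) / det g` of a metric on a plane domain. -/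
def gaussCurvature (g : Plane → Matrix (Fin 2) (Fin 2) ℝ) (p : Plane) : ℝ :=
  (∑ l, g p 0 l * riemannCurvature g l 1 0 1 p) / (g p).det

/-- `X` is of class `C^{1,1}` on the open set `U`: it is differentiable there and its derivative is
locally Lipschitz. -/
def IsC11On (X : Plane → Space) (U : Set Plane) : Prop :=
  DifferentiableOn ℝ X U ∧ LocallyLipschitzOn U (fderiv ℝ X)

/-- `X` restricted to the open set `U` is an isometric embedding of `(U, g)` into flat three-space:
a differentiable topological embedding which pulls the canonical metric back to `g`. -/
structure IsIsometricEmbeddingOn (g : Plane → Matrix (Fin 2) (Fin 2) ℝ) (U : Set Plane)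
    (X : Plane → Space) : Prop where
  isEmbedding : Topology.IsEmbedding (U.domRestrict X)
  differentiableOn : DifferentiableOn ℝ X U
  pullback : ∀ p ∈ U, ∀ v w : Plane,
    inner ℝ (fderiv ℝ X p v) (fderiv ℝ X p w) = ∑ i, ∑ j, g p i j * v i * w j

end

/-! The metric of the graph is `g i j = δ i j + u_i u_j`, so all products `u_i u_j` are smooth,
although the `u_i` are only known to be continuous. Where some `u_k ≠ 0`, it is `±√(u_k²)`, hence
smooth, and the other partial derivative is a quotient. The whole difficulty lies at critical points
of `u`.

At such a point, suppose `u` is smooth nearby off the point, with positive curvature, and some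
`u_i²` has nonzero second derivative in direction `i`. Positive curvature gives `det Hess u > 0`, so
`u_ii` has a constant sign on a punctured disc. Then `s = ∂_i (u_i²) = 2 u_i u_ii` vanishes only
where `u_i` does, and two Hadamard divisions give `u_i² = s² e` with `e > 0`, whence `u_i = ± s √e`
is smooth. Dividing `u_i u_j` by `s` treats `u_j` (`contDiffAt_of_sq_of_mul`).

It remains to verify the assumptions. If the curvature is positive at the critical point itself, it
is a linear expression in the second derivatives of the `u_i u_j`. Together with the nonnegative
Hessians of all `(s u_0 + t u_1)²`, this makes the critical point isolated and some `u_i²`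
nondegenerate.

At the origin the curvature may vanish. If both `u_i²` were degenerate there, `u` would be `o(t²)`
on both axes, hence by convexity `o(|z|²)` in all directions. A comparison with a paraboloid
contradicts `Δu > C₀` (`not_flat_of_laplacian_lower_bound`). -/

open Filter Topology

/-! ### Division of smooth functions: Hadamard's lemma. -/

section Division

variable {E F : Type} [NormedAddCommGroup E] [NormedSpace ℝ E] [FiniteDimensional ℝ E]
  [NormedAddCommGroup F] [NormedSpace ℝ F]

/-- Differentiation under an integral over a compact interval, for a `C^1` integrand. -/
theorem hasFDerivAt_intervalIntegral_of_contDiff {G : E × ℝ → F} (hG : ContDiff ℝ 1 G) (x : E) :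
    HasFDerivAt (fun x => ∫ t in (0 : ℝ)..1, G (x, t))
      (∫ t in (0 : ℝ)..1, (fderiv ℝ G (x, t)).comp (ContinuousLinearMap.inl ℝ E ℝ)) x := by
  have hd : Continuous fun y : E × ℝ => (fderiv ℝ G y).comp (ContinuousLinearMap.inl ℝ E ℝ) :=
    (hG.continuous_fderiv one_ne_zero).clm_comp continuous_const
  obtain ⟨C, hC⟩ := ((isCompact_closedBall x 1).prod (isCompact_Icc (a := (0 : ℝ)) (b := 1))
    |>.exists_bound_of_continuousOn hd.continuousOn)
  refine intervalIntegral.hasFDerivAt_integral_of_dominated_of_fderiv_le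
    (F' := fun y t => (fderiv ℝ G (y, t)).comp (ContinuousLinearMap.inl ℝ E ℝ))
    (bound := fun _ => C)
    (Metric.ball_mem_nhds x one_pos) ?_ ?_ ?_ ?_ ?_ ?_
  · exact Eventually.of_forall fun y =>
      (hG.continuous.comp (by fun_prop : Continuous fun t : ℝ => (y, t))).aestronglyMeasurable
  · exact (hG.continuous.comp (by fun_prop : Continuous fun t : ℝ => (x, t))).intervalIntegrable _ _
  · exact (hd.comp (by fun_prop : Continuous fun t : ℝ => (x, t))).aestronglyMeasurable
  · refine Eventually.of_forall fun t ht y hy => hC (y, t) ⟨Metric.ball_subset_closedBall hy, ?_⟩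
    rw [Set.uIoc_of_le zero_le_one] at ht
    exact Set.Ioc_subset_Icc_self ht
  · exact intervalIntegrable_const
  · refine Eventually.of_forall fun t _ y _ => ?_
    exact ((hG.differentiable one_ne_zero) (y, t)).hasFDerivAt.comp y
      (hasFDerivAt_prodMk_left y t)

/-- The induction must range over all `F`, since the derivative takes values in `E →L[ℝ] F`. -/
theorem contDiff_intervalIntegral (n : ℕ) : ∀ {F : Type} [NormedAddCommGroup F] [NormedSpace ℝ F]
    [CompleteSpace F] {G : E × ℝ → F}, ContDiff ℝ n G →
      ContDiff ℝ n fun x => ∫ t in (0 : ℝ)..1, G (x, t) := by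
  induction n with
  | zero =>
    intro F _ _ _ G hG
    rw [Nat.cast_zero, contDiff_zero] at hG ⊢
    exact intervalIntegral.continuous_parametric_intervalIntegral_of_continuous'
      (f := fun x t => G (x, t)) hG 0 1
  | succ n ih =>
    intro F _ _ _ G hG
    have h1 : ContDiff ℝ 1 G := hG.of_le (by exact_mod_cast Nat.le_add_left 1 n)
    have key := hasFDerivAt_intervalIntegral_of_contDiff h1
    rw [Nat.cast_succ] at hG ⊢
    rw [contDiff_succ_iff_fderiv]
    refine ⟨fun x => (key x).differentiableAt, by simp, ?_⟩
    have : fderiv ℝ (fun x => ∫ t in (0 : ℝ)..1, G (x, t)) = fun x =>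
        ∫ t in (0 : ℝ)..1, (fderiv ℝ G (x, t)).comp (ContinuousLinearMap.inl ℝ E ℝ) :=
      funext fun x => (key x).fderiv
    rw [this]
    exact ih (G := fun y => (fderiv ℝ G y).comp (ContinuousLinearMap.inl ℝ E ℝ))
      ((hG.fderiv_right le_rfl).clm_comp contDiff_const)

/-- **Hadamard's lemma**, global form. -/
theorem exists_contDiff_eq_mul_of_eq_zero {n : ℕ} {f : E → ℝ} (hf : ContDiff ℝ (n + 1) f)
    (l : E →L[ℝ] ℝ) {e : E} (he : l e = 1) (h0 : ∀ z, l z = 0 → f z = 0) :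
    ∃ h : E → ℝ, ContDiff ℝ n h ∧ ∀ z, f z = l z * h z := by
  -- For fixed `z`, `t ↦ π (z, t)` runs along `e` from the projection of `z` to `ker l` (at `t = 0`)
  -- to `z` (at `t = 1`).
  let π : E × ℝ → E := fun y => y.1 - ((1 - y.2) * l y.1) • e
  have hπ : ContDiff ℝ n π := by unfold π; fun_prop
  have hc : ContDiff ℝ n fun y => fderiv ℝ f (π y) e :=
    ((hf.fderiv_right le_rfl).comp hπ).clm_apply contDiff_const
  refine ⟨fun z => ∫ t in (0 : ℝ)..1, fderiv ℝ f (π (z, t)) e, contDiff_intervalIntegral n hc,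
    fun z => ?_⟩
  have hd : ∀ t ∈ Set.uIcc (0 : ℝ) 1,
      HasDerivAt (fun t => f (π (z, t))) (l z * fderiv ℝ f (π (z, t)) e) t := by
    intro t _
    have h1 : HasDerivAt (fun t => π (z, t)) (l z • e) t := by
      have : HasDerivAt (fun t : ℝ => (1 - t) * l z) (-1 * l z) t :=
        ((hasDerivAt_id t).const_sub 1).mul_const _
      simpa [π] using (this.smul_const e).const_sub z
    have h2 := ((hf.differentiable (by simp)) (π (z, t))).hasFDerivAt.comp_hasDerivAt t h1
    rw [map_smul, smul_eq_mul] at h2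
    exact h2
  have hi : IntervalIntegrable (fun t => l z * fderiv ℝ f (π (z, t)) e) MeasureTheory.volume 0 1 :=
    ((hc.continuous.comp (by fun_prop : Continuous fun t : ℝ => (z, t))).const_smul
      (l z)).intervalIntegrable _ _
  have := intervalIntegral.integral_eq_sub_of_hasDerivAt hd hi
  rw [intervalIntegral.integral_const_mul] at this
  rw [this]
  have h3 : f (π (z, 0)) = 0 := h0 _ (by simp [π, he])
  rw [h3]
  simp [π]

/-- **Hadamard's lemma**, local form. -/
theorem exists_contDiffAt_eq_mul_of_eventually {n : ℕ} {f : E → ℝ} (hf : ContDiffAt ℝ (n + 1) f 0)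
    (l : E →L[ℝ] ℝ) {e : E} (he : l e = 1) (h0 : ∀ᶠ z in 𝓝 0, l z = 0 → f z = 0) :
    ∃ h : E → ℝ, ContDiffAt ℝ n h 0 ∧ ∀ᶠ z in 𝓝 0, f z = l z * h z := by
  obtain ⟨ε, hε, hball⟩ := Metric.eventually_nhds_iff_ball.1
    ((hf.eventually (by exact_mod_cast ENat.natCast_ne_top (n + 1))).and h0)
  let χ : ContDiffBump (0 : E) := ⟨ε / 3, ε / 2, by positivity, by linarith⟩
  have hχ : ContDiff ℝ (n + 1) fun z => χ z * f z := by
    rw [contDiff_iff_contDiffAt]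
    intro z
    by_cases hz : z ∈ Metric.ball (0 : E) ε
    · exact χ.contDiffAt.mul (hball z hz).1
    · have : (fun z => χ z * f z) =ᶠ[𝓝 z] fun _ => 0 := by
        have hz' : z ∈ (Metric.closedBall (0 : E) (ε / 2))ᶜ := by
          simp only [Metric.mem_ball, not_lt, Set.mem_compl_iff, Metric.mem_closedBall,
            not_le] at hz ⊢
          linarith
        filter_upwards [Metric.isClosed_closedBall.isOpen_compl.mem_nhds hz'] with y hy
        rw [χ.zero_of_le_dist (by simpa using (show ε / 2 < dist y 0 by simpa using hy).le), zero_mul]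
      exact contDiffAt_const.congr_of_eventuallyEq this
  obtain ⟨h, hh, hmul⟩ := exists_contDiff_eq_mul_of_eq_zero hχ l he (fun z hz => by
    by_cases hzb : z ∈ Metric.ball (0 : E) ε
    · rw [(hball z hzb).2 hz, mul_zero]
    · simp only [Metric.mem_ball, not_lt] at hzb
      rw [χ.zero_of_le_dist (by simp only [χ]; linarith), zero_mul])
  refine ⟨h, hh.contDiffAt, ?_⟩
  filter_upwards [χ.eventuallyEq_one] with z hz
  rw [← hmul, hz, Pi.one_apply, one_mul]

/-- A function vanishing on the regular zero set of `s` is divisible by `s`. -/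
theorem exists_contDiffAt_eq_mul {n : ℕ} {s f : E → ℝ} {p v : E} (hs : ContDiffAt ℝ (n + 1) s p)
    (hf : ContDiffAt ℝ (n + 1) f p) (hsp : s p = 0) (hv : fderiv ℝ s p v ≠ 0)
    (h0 : ∀ᶠ q in 𝓝 p, s q = 0 → f q = 0) :
    ∃ h : E → ℝ, ContDiffAt ℝ n h p ∧ ∀ᶠ q in 𝓝 p, f q = s q * h q := by
  set l := fderiv ℝ s p with hl
  let e : E := (l v)⁻¹ • v
  have he : l e = 1 := by simp [e, hv]
  -- Straightening chart: its derivative at `p` is the identity, and `l ∘ Ψ = s` because `l e = 1`.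
  -- So `s` becomes linear.
  let Ψ : E → E := fun q => q - p + (s q - l (q - p)) • e
  have hΨ : ContDiffAt ℝ (n + 1) Ψ p := by unfold Ψ; fun_prop
  have hlΨ : ∀ q, l (Ψ q) = s q := fun q => by simp [Ψ, he]
  have hΨp : Ψ p = 0 := by simp [Ψ, hsp]
  have hn : ((n : WithTop ℕ∞) + 1) ≠ 0 := by simp
  have hΨ' : HasFDerivAt Ψ ((ContinuousLinearEquiv.refl ℝ E : E ≃L[ℝ] E) : E →L[ℝ] E) p := by
    have h1 : HasFDerivAt (fun q : E => q - p) (ContinuousLinearMap.id ℝ E) p :=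
      (hasFDerivAt_id p).sub_const p
    have h2 : HasFDerivAt s l p := (hs.differentiableAt hn).hasFDerivAt
    have h3 := h1.add ((h2.sub (l.hasFDerivAt.comp p h1)).smul_const e)
    rw [ContinuousLinearMap.comp_id, sub_self] at h3
    have h4 : ContinuousLinearMap.id ℝ E + (0 : E →L[ℝ] ℝ).smulRight e =
        ((ContinuousLinearEquiv.refl ℝ E : E ≃L[ℝ] E) : E →L[ℝ] E) := by ext w; simp
    exact h4 ▸ h3
  set g := hΨ.localInverse hΨ' hn with hg
  have hgc : ContDiffAt ℝ (n + 1) g 0 := hΨp ▸ hΨ.to_localInverse hΨ' hn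
  have hstrict := hΨ.hasStrictFDerivAt' hΨ' hn
  have hgp : g 0 = p := by
    have := hstrict.localInverse_apply_image
    rwa [hΨp] at this
  have hright : ∀ᶠ z in 𝓝 (0 : E), Ψ (g z) = z := by
    have := hstrict.eventually_right_inverse
    rwa [hΨp] at this
  have hleft : ∀ᶠ q in 𝓝 p, g (Ψ q) = q := hstrict.eventually_left_inverse
  have hgt : Tendsto g (𝓝 0) (𝓝 p) := hgp ▸ hgc.continuousAt.tendsto
  have hΨt : Tendsto Ψ (𝓝 p) (𝓝 0) := hΨp ▸ hΨ.continuousAt.tendsto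
  obtain ⟨h, hh, hmul⟩ := exists_contDiffAt_eq_mul_of_eventually (f := fun z => f (g z))
    (ContDiffAt.comp 0 (hgp.symm ▸ hf) hgc) l he (by
      filter_upwards [hright, hgt.eventually h0] with z hz hz0 hlz
      exact hz0 (by rw [← hlΨ, hz, hlz]))
  refine ⟨fun q => h (Ψ q), ContDiffAt.comp p (hΨp.symm ▸ hh) (hΨ.of_le (by simp)), ?_⟩
  filter_upwards [hleft, hΨt.eventually hmul] with q hq hq'
  rw [hq, hlΨ] at hq'
  exact hq'

end Division

/-! ### Smooth square roots. -/

section SquareRoot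

variable {E : Type} [NormedAddCommGroup E] [NormedSpace ℝ E]

/-- This permits cancelling a factor `s` from relations between continuous functions, even at zeros
of `s`. -/
theorem frequently_ne_zero_of_fderiv_ne_zero {s : E → ℝ} {q v : E} (h : fderiv ℝ s q v ≠ 0) :
    ∃ᶠ z in 𝓝 q, s z ≠ 0 := by
  intro hz
  apply h
  have : s =ᶠ[𝓝 q] fun _ => 0 := by
    filter_upwards [hz] with z hz using not_not.1 hz
  rw [this.fderiv_eq]
  simp

/-- A continuous function which vanishes where `s ≠ 0` vanishes at the regular points of `s`. -/
theorem eq_zero_of_mul_eventually_eq_zero {s f : E → ℝ} {q v : E} (h : fderiv ℝ s q v ≠ 0)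
    (hf : ContinuousAt f q) (hsf : ∀ᶠ z in 𝓝 q, s z * f z = 0) : f q = 0 := by
  by_contra hne
  refine frequently_ne_zero_of_fderiv_ne_zero h ?_
  filter_upwards [hsf, hf.eventually_ne hne] with z hz hz' hs
  exact (mul_ne_zero hs hz') hz

theorem nonneg_of_mul_sq_eventually_nonneg {s f : E → ℝ} {q v : E} (h : fderiv ℝ s q v ≠ 0)
    (hf : ContinuousAt f q) (hsf : ∀ᶠ z in 𝓝 q, 0 ≤ s z ^ 2 * f z) : 0 ≤ f q := by
  by_contra! hne
  refine frequently_ne_zero_of_fderiv_ne_zero h ?_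
  filter_upwards [hsf, hf.eventually (gt_mem_nhds hne)] with z hz hz' hs
  have := mul_neg_of_pos_of_neg (by positivity : 0 < s z ^ 2) hz'
  linarith

theorem ContDiffAt.fderiv_apply_const {n : ℕ} {f : E → ℝ} {p : E} (hf : ContDiffAt ℝ (n + 1) f p)
    (v : E) : ContDiffAt ℝ n (fun q => fderiv ℝ f q v) p :=
  (hf.fderiv_right le_rfl).clm_apply contDiffAt_const

variable [FiniteDimensional ℝ E]

/-- If `f` has a nondegenerate second derivative along `v` at `p`, and vanishes wherever its
derivative `s` along `v` does, then `f = s ^ 2 * e` with `0 < e p`. -/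
theorem exists_eq_sq_mul {n : ℕ} {f : E → ℝ} {p v : E} (hf : ContDiffAt ℝ ∞ f p)
    (hnn : ∀ q, 0 ≤ f q)
    (hsp : fderiv ℝ f p v = 0) (hss : fderiv ℝ (fun q => fderiv ℝ f q v) p v ≠ 0)
    (h0 : ∀ᶠ q in 𝓝 p, fderiv ℝ f q v = 0 → f q = 0) :
    ∃ e : E → ℝ, ContDiffAt ℝ n e p ∧ 0 < e p ∧
      ∀ᶠ q in 𝓝 p, f q = fderiv ℝ f q v ^ 2 * e q := by
  have hle : ∀ m : ℕ, ContDiffAt ℝ m f p := fun m => hf.of_le (mod_cast le_top)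
  set s : E → ℝ := fun q => fderiv ℝ f q v with hs
  have hsm : ∀ m : ℕ, ContDiffAt ℝ m s p := fun m => (hle (m + 1)).fderiv_apply_const v
  have hsv : ∀ᶠ q in 𝓝 p, fderiv ℝ s q v ≠ 0 :=
    ((hsm 1).fderiv_apply_const (n := 0) v).continuousAt.eventually_ne hss
  have hsd : ∀ᶠ q in 𝓝 p, DifferentiableAt ℝ s q :=
    ((hsm 1).eventually (by simp)).mono fun q hq => hq.differentiableAt (by simp)
  -- Each of the two divisions costs one derivative; the spare order leaves `e` of class `C^(n+1)`,
  -- so differentiable even if `n = 0`.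
  obtain ⟨h, hh, hfh⟩ := exists_contDiffAt_eq_mul (n := n + 2) (hsm _) (hle _) hsp hss h0
  have hhd : ∀ᶠ q in 𝓝 p, DifferentiableAt ℝ h q :=
    (((hh.of_le (by exact_mod_cast Nat.le_add_left 1 (n + 1)) : ContDiffAt ℝ (1 : ℕ) h p)).eventually
      (by simp)).mono fun q hq => hq.differentiableAt (by simp)
  -- Differentiate `f = s h` along `v`: where `s = 0`, nonvanishing of `∂_v s` forces `h = 0`, so
  -- `h` is again divisible by `s`.
  have hsh : ∀ᶠ q in 𝓝 p, s q = fderiv ℝ s q v * h q + s q * fderiv ℝ h q v := by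
    filter_upwards [hfh.eventually_nhds, hsd, hhd] with q hq hq1 hq2
    have h1 : fderiv ℝ f q = fderiv ℝ (fun q => s q * h q) q := Filter.EventuallyEq.fderiv_eq hq
    conv_lhs => rw [hs]
    simp only [h1]
    rw [fderiv_fun_mul hq1 hq2]
    simp
    ring
  obtain ⟨e, he, hhe⟩ := exists_contDiffAt_eq_mul (n := n + 1) (hsm _) hh hsp hss (by
    filter_upwards [hsh, hsv] with q hq hq1 hq0
    rw [hq0, zero_mul, add_zero] at hq
    exact (mul_eq_zero.1 hq.symm).resolve_left hq1)
  have hfe : ∀ᶠ q in 𝓝 p, f q = s q ^ 2 * e q := by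
    filter_upwards [hfh, hhe] with q h1 h2
    rw [h1, h2]; ring
  have hed : ∀ᶠ q in 𝓝 p, DifferentiableAt ℝ e q :=
    (((he.of_le (by exact_mod_cast Nat.le_add_left 1 n) : ContDiffAt ℝ (1 : ℕ) e p)).eventually
      (by simp)).mono fun q hq => hq.differentiableAt (by simp)
  refine ⟨e, he.of_le (by simp), lt_of_le_of_ne ?_ ?_, hfe⟩
  · refine nonneg_of_mul_sq_eventually_nonneg hss he.continuousAt ?_
    filter_upwards [hfe] with q hq
    rw [← hq]; exact hnn q
  · intro hep
    -- Differentiating `f = s² e` along `v` and cancelling `s` gives `1 = 2 (∂_v s) e + s ∂_v e`,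
    -- which is impossible at `p` if `e p = 0`.
    have hc : ContinuousAt (fun q => 1 - 2 * fderiv ℝ s q v * e q - s q * fderiv ℝ e q v) p := by
      have h1 := ((hsm 1).fderiv_apply_const (n := 0) v).continuousAt
      have h2 := ((he.of_le (by simp) : ContDiffAt ℝ ((0 : ℕ) + 1) e p).fderiv_apply_const
        (n := 0) v).continuousAt
      have h3 := (hsm 0).continuousAt
      have h4 := he.continuousAt
      fun_prop
    have := eq_zero_of_mul_eventually_eq_zero hss hc (by
      filter_upwards [hfe.eventually_nhds, hsd, hed] with q hq hq1 hq2
      have h1 : fderiv ℝ f q = fderiv ℝ (fun q => s q ^ 2 * e q) q :=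
        Filter.EventuallyEq.fderiv_eq hq
      have h2 : s q = 2 * s q * fderiv ℝ s q v * e q + s q ^ 2 * fderiv ℝ e q v := by
        conv_lhs => rw [hs]
        simp only [h1]
        rw [fderiv_fun_mul (hq1.fun_pow 2) hq2, fderiv_fun_pow 2 hq1]
        simp
        ring
      linear_combination h2)
    have hsp' : s p = 0 := hsp
    simp [← hep, hsp'] at this

/-- A function `a` whose square is smooth is smooth at a zero `p`, together with any `b` for which
`a * b` is smooth, provided that `a` is strictly monotone in a direction `v` and that the square is
nondegenerate in this direction at `p`. -/
theorem contDiffAt_of_sq_of_mul {a b : E → ℝ} {p v : E} {σ : ℝ} (hσ : σ ^ 2 = 1)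
    (hF : ContDiffAt ℝ ∞ (fun q => a q ^ 2) p) (hG : ContDiffAt ℝ ∞ (fun q => a q * b q) p)
    (hb : ∀ᶠ q in 𝓝 p, ContinuousAt b q)
    (hap : a p = 0) (hd : ∀ᶠ q in 𝓝[≠] p, DifferentiableAt ℝ a q)
    (hsign : ∀ᶠ q in 𝓝[≠] p, 0 < σ * fderiv ℝ a q v)
    (hss : fderiv ℝ (fun q => fderiv ℝ (fun q => a q ^ 2) q v) p v ≠ 0) :
    ContDiffAt ℝ ∞ a p ∧ ContDiffAt ℝ ∞ b p := by
  set f : E → ℝ := fun q => a q ^ 2 with hf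
  have hsp : fderiv ℝ f p v = 0 := by
    have : IsLocalMin f p := Eventually.of_forall fun q => by
      simpa [hf, hap] using sq_nonneg (a q)
    rw [this.fderiv_eq_zero]; rfl
  -- Off `p` one has `c = 2 σ ∂_v a > 0`. At `p`, where `a` may fail to be differentiable, `c = 0`
  -- serves.
  have hsa : ∀ᶠ q in 𝓝 p, ∃ c : ℝ, 0 ≤ c ∧ (c = 0 → a q = 0) ∧
      σ * fderiv ℝ f q v = c * a q := by
    rw [eventually_nhdsWithin_iff] at hd hsign
    filter_upwards [hd, hsign] with q h1 h2
    by_cases hq : q = p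
    · exact ⟨0, le_rfl, fun _ => hq ▸ hap, by rw [hq, hsp]; ring⟩
    · refine ⟨2 * (σ * fderiv ℝ a q v), by linarith [h2 hq], fun h => by linarith [h2 hq], ?_⟩
      rw [hf, fderiv_fun_pow 2 (h1 hq)]
      simp
      ring
  have hσ0 : σ ≠ 0 := by rintro rfl; norm_num at hσ
  have h0 : ∀ᶠ q in 𝓝 p, fderiv ℝ f q v = 0 → a q = 0 := by
    filter_upwards [hsa] with q ⟨c, hc, hc0, hq⟩ h
    rw [h, mul_zero] at hq
    rcases mul_eq_zero.1 hq.symm with h | h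
    · exact hc0 h
    · exact h
  have hle : ∀ m : ℕ, ContDiffAt ℝ m f p := fun m => hF.of_le (mod_cast le_top)
  have hsm : ∀ m : ℕ, ContDiffAt ℝ m (fun q => fderiv ℝ f q v) p :=
    fun m => (hle (m + 1)).fderiv_apply_const v
  rw [contDiffAt_infty, contDiffAt_infty, ← forall_and]
  -- The functions `e` and `k` may depend on `n`; `a` and `b` do not.
  intro n
  obtain ⟨e, he, hep, hfe⟩ := exists_eq_sq_mul (n := n) hF (fun q => sq_nonneg _) hsp hss
    (h0.mono fun q hq h => by simp [hf, hq h])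
  obtain ⟨k, hk, hGk⟩ := exists_contDiffAt_eq_mul (n := n) (hsm _)
    (hG.of_le (by exact_mod_cast le_top)) hsp hss (h0.mono fun q hq h => by simp [hq h])
  have hsq : ContDiffAt ℝ n (fun q => √(e q)) p := he.sqrt hep.ne'
  have hpos : ∀ᶠ q in 𝓝 p, 0 < e q := he.continuousAt.eventually (lt_mem_nhds hep)
  have haeq : ∀ᶠ q in 𝓝 p, a q = σ * fderiv ℝ f q v * √(e q) := by
    filter_upwards [hfe, hpos, hsa, h0] with q h1 h2 ⟨c, hc, hc0, hq⟩ h3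
    have h4 : √(e q) ^ 2 = e q := Real.sq_sqrt h2.le
    have h5 : 0 < √(e q) := Real.sqrt_pos.2 h2
    -- Of the two roots, the one with the wrong sign gives `a (1 + c √e) = 0`, so `a = 0` and both
    -- roots agree.
    have h6 : (a q - σ * fderiv ℝ f q v * √(e q)) * (a q + σ * fderiv ℝ f q v * √(e q)) = 0 := by
      have : a q ^ 2 = fderiv ℝ f q v ^ 2 * e q := h1
      linear_combination this - fderiv ℝ f q v ^ 2 * √(e q) ^ 2 * hσ - fderiv ℝ f q v ^ 2 * h4
    rcases mul_eq_zero.1 h6 with h | h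
    · linarith
    · rw [hq] at h ⊢
      have h7 : a q * (1 + c * √(e q)) = 0 := by linear_combination h
      have h8 : (1 + c * √(e q)) ≠ 0 := by positivity
      rw [(mul_eq_zero.1 h7).resolve_right h8]
      ring
  have hbeq : ∀ᶠ q in 𝓝 p, b q = k q / (σ * √(e q)) := by
    have hsv : ∀ᶠ q in 𝓝 p, fderiv ℝ (fun q => fderiv ℝ f q v) q v ≠ 0 :=
      ((hsm 1).fderiv_apply_const (n := 0) v).continuousAt.eventually_ne hss
    have hkc : ∀ᶠ q in 𝓝 p, ContinuousAt k q :=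
      (hk.eventually (by simp)).mono fun q hq => hq.continuousAt
    have hec : ∀ᶠ q in 𝓝 p, ContinuousAt (fun q => √(e q)) q :=
      (hsq.eventually (by simp)).mono fun q hq => hq.continuousAt
    filter_upwards [hsv, hkc, hec, hb, hpos, (haeq.and hGk).eventually_nhds] with q h1 h2 h3 h4 h5 h6
    have h7 : 0 < √(e q) := Real.sqrt_pos.2 h5
    -- From `a b = s k` and `a = σ s √e`, with `s` cancelled by continuity.
    have h8 := eq_zero_of_mul_eventually_eq_zero (f := fun q => σ * √(e q) * b q - k q) h1
      (by fun_prop) (h6.mono fun z hz => by linear_combination hz.2 - b z * hz.1)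
    rw [eq_div_iff (mul_ne_zero hσ0 h7.ne')]
    linear_combination h8
  refine ⟨(((contDiffAt_const (c := σ)).mul (hsm n)).mul hsq).congr_of_eventuallyEq haeq,
    (hk.div (contDiffAt_const.mul hsq) ?_).congr_of_eventuallyEq hbeq⟩
  exact mul_ne_zero hσ0 (Real.sqrt_pos.2 hep).ne'

end SquareRoot

/-! ### Second derivatives and partial derivatives in the plane. -/

section Calculus

theorem DifferentiableAt.hasDerivAt_line {E : Type} [NormedAddCommGroup E] [NormedSpace ℝ E]
    {f : E → ℝ} {q v : E} {t : ℝ} (hf : DifferentiableAt ℝ f (q + t • v)) :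
    HasDerivAt (fun t : ℝ => f (q + t • v)) (fderiv ℝ f (q + t • v) v) t := by
  have h1 : HasDerivAt (fun t : ℝ => q + t • v) v t := by
    simpa using ((hasDerivAt_id t).smul_const v).const_add q
  exact hf.hasFDerivAt.comp_hasDerivAt t h1

theorem ContDiffAt.hasDerivAt_deriv_line {E : Type} [NormedAddCommGroup E] [NormedSpace ℝ E]
    {f : E → ℝ} {q v : E} {t : ℝ} (hf : ContDiffAt ℝ 2 f (q + t • v)) :
    HasDerivAt (deriv fun t : ℝ => f (q + t • v))
      (fderiv ℝ (fun z => fderiv ℝ f z v) (q + t • v) v) t := by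
  have hc : ContinuousAt (fun t : ℝ => q + t • v) t := by fun_prop
  have h1 : (deriv fun t : ℝ => f (q + t • v)) =ᶠ[𝓝 t] fun t => fderiv ℝ f (q + t • v) v := by
    filter_upwards [hc.eventually (hf.eventually (by simp))] with s hs
    exact (DifferentiableAt.hasDerivAt_line (hs.differentiableAt (by simp))).deriv
  refine HasDerivAt.congr_of_eventuallyEq ?_ h1
  have h2 : ContDiffAt ℝ (1 : ℕ) (fun z => fderiv ℝ f z v) (q + t • v) :=
    ContDiffAt.fderiv_apply_const (by exact_mod_cast hf) v
  exact DifferentiableAt.hasDerivAt_line (h2.differentiableAt (by simp))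

/-- A negative second derivative would make `t` a local maximum as well, so `f` would be locally
constant. -/
theorem IsLocalMin.deriv_deriv_nonneg {f : ℝ → ℝ} {t : ℝ} (h : IsLocalMin f t)
    (hc : ContinuousAt f t) : 0 ≤ deriv (deriv f) t := by
  by_contra! hlt
  have h2 := isLocalMax_of_deriv_deriv_neg hlt h.deriv_eq_zero hc
  have h3 : f =ᶠ[𝓝 t] fun _ => f t := by
    filter_upwards [h, h2] with s hs hs' using le_antisymm hs' hs
  have h4 := h3.deriv.deriv_eq
  simp at h4
  linarith

theorem IsLocalMin.fderiv_fderiv_nonneg {E : Type} [NormedAddCommGroup E] [NormedSpace ℝ E]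
    {f : E → ℝ} {p : E} (h : IsLocalMin f p) (hf : ContDiffAt ℝ 2 f p) (v : E) :
    0 ≤ fderiv ℝ (fun z => fderiv ℝ f z v) p v := by
  have hf' : ContDiffAt ℝ 2 f (p + (0 : ℝ) • v) := by simpa using hf
  have h1 := hf'.hasDerivAt_deriv_line.deriv
  have hc : ContinuousAt (fun t : ℝ => p + t • v) 0 := by fun_prop
  have h2 : IsLocalMin (fun t : ℝ => f (p + t • v)) 0 := by
    have := hc.tendsto.eventually (show ∀ᶠ z in 𝓝 (p + (0 : ℝ) • v), f p ≤ f z by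
      rw [zero_smul, add_zero]; exact h)
    filter_upwards [this] with t ht
    simpa using ht
  have h3 := h2.deriv_deriv_nonneg
    (ContinuousAt.comp (f := fun t : ℝ => p + t • v) (g := f) hf'.continuousAt hc)
  rw [h1] at h3
  simpa using h3

theorem fderiv_fderiv_apply {E : Type} [NormedAddCommGroup E] [NormedSpace ℝ E]
    {f : E → ℝ} {p : E} (hf : ContDiffAt ℝ 2 f p) (v w : E) :
    fderiv ℝ (fun z => fderiv ℝ f z v) p w = fderiv ℝ (fderiv ℝ f) p w v := by
  have h : DifferentiableAt ℝ (fderiv ℝ f) p :=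
    (hf.fderiv_right (m := 1) (by norm_num)).differentiableAt (by simp)
  rw [fderiv_clm_apply h (by simp)]
  simp

theorem partialD_partialD {f : Plane → ℝ} {p : Plane} (hf : ContDiffAt ℝ 2 f p) (i j : Fin 2) :
    partialD i (partialD j f) p =
      fderiv ℝ (fderiv ℝ f) p (EuclideanSpace.single i 1) (EuclideanSpace.single j 1) :=
  fderiv_fderiv_apply hf _ _

theorem partialD_comm {f : Plane → ℝ} {p : Plane} (hf : ContDiffAt ℝ 2 f p) (i j : Fin 2) :
    partialD i (partialD j f) p = partialD j (partialD i f) p := by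
  rw [partialD_partialD hf, partialD_partialD hf]
  exact (hf.isSymmSndFDerivAt (by simp)).eq _ _

theorem plane_eq (v : Plane) :
    v = v 0 • EuclideanSpace.single 0 1 + v 1 • EuclideanSpace.single 1 1 := by
  ext i; fin_cases i <;> simp

theorem fderiv_apply_eq {f : Plane → ℝ} {p : Plane} (v : Plane) :
    fderiv ℝ f p v = v 0 * partialD 0 f p + v 1 * partialD 1 f p := by
  conv_lhs => rw [plane_eq v]
  simp [partialD]

theorem fderiv_fderiv_apply_self {f : Plane → ℝ} {p : Plane} (hf : ContDiffAt ℝ 2 f p)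
    (v : Plane) :
    fderiv ℝ (fun z => fderiv ℝ f z v) p v = v 0 ^ 2 * partialD 0 (partialD 0 f) p +
      2 * v 0 * v 1 * partialD 0 (partialD 1 f) p + v 1 ^ 2 * partialD 1 (partialD 1 f) p := by
  rw [fderiv_fderiv_apply hf]
  have h := partialD_comm hf 0 1
  rw [partialD_partialD hf, partialD_partialD hf] at h
  rw [partialD_partialD hf, partialD_partialD hf, partialD_partialD hf]
  nth_rw 1 [plane_eq v]
  nth_rw 3 [plane_eq v]
  simp only [map_add, map_smul, add_apply, smul_apply,
    smul_eq_mul]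
  linear_combination -v 0 * v 1 * h

theorem ContDiffAt.partialD {n : ℕ} {f : Plane → ℝ} {p : Plane} (hf : ContDiffAt ℝ (n + 1) f p)
    (i : Fin 2) : ContDiffAt ℝ n (partialD i f) p :=
  hf.fderiv_apply_const _

theorem partialD_fun_mul {f h : Plane → ℝ} {p : Plane} (hf : DifferentiableAt ℝ f p)
    (hh : DifferentiableAt ℝ h p) (i : Fin 2) :
    partialD i (fun q => f q * h q) p = f p * partialD i h p + h p * partialD i f p := by
  simp [partialD, fderiv_fun_mul hf hh]

theorem partialD_fun_add {f h : Plane → ℝ} {p : Plane} (hf : DifferentiableAt ℝ f p)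
    (hh : DifferentiableAt ℝ h p) (i : Fin 2) :
    partialD i (fun q => f q + h q) p = partialD i f p + partialD i h p := by
  simp [partialD, fderiv_fun_add hf hh]

theorem partialD_fun_sub {f h : Plane → ℝ} {p : Plane} (hf : DifferentiableAt ℝ f p)
    (hh : DifferentiableAt ℝ h p) (i : Fin 2) :
    partialD i (fun q => f q - h q) p = partialD i f p - partialD i h p := by
  simp [partialD, fderiv_fun_sub hf hh]

theorem partialD_const_mul {f : Plane → ℝ} {p : Plane} (hf : DifferentiableAt ℝ f p) (c : ℝ)
    (i : Fin 2) : partialD i (fun q => c * f q) p = c * partialD i f p := by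
  simp [partialD, fderiv_const_mul hf]

theorem partialD_fun_inv {f : Plane → ℝ} {p : Plane} (hf : DifferentiableAt ℝ f p)
    (h0 : f p ≠ 0) (i : Fin 2) :
    partialD i (fun q => (f q)⁻¹) p = -partialD i f p / f p ^ 2 := by
  have := ((hasDerivAt_inv h0).comp_hasFDerivAt p hf.hasFDerivAt).fderiv
  have h2 : fderiv ℝ (fun q => (f q)⁻¹) p = (-(f p ^ 2)⁻¹) • fderiv ℝ f p := this
  simp only [partialD, h2]
  simp
  ring

theorem partialD_congr {f h : Plane → ℝ} {p : Plane} (hfh : f =ᶠ[𝓝 p] h) (i : Fin 2) :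
    partialD i f p = partialD i h p := by
  simp only [partialD, hfh.fderiv_eq]

theorem partialD_eventuallyEq {f h : Plane → ℝ} {p : Plane} (hfh : f =ᶠ[𝓝 p] h) (i : Fin 2) :
    partialD i f =ᶠ[𝓝 p] partialD i h := by
  filter_upwards [hfh.eventuallyEq_nhds] with q hq using partialD_congr hq i

theorem hasFDerivAt_of_partialD {f : Plane → ℝ} {p : Plane} (hf : DifferentiableAt ℝ f p) :
    HasFDerivAt f (∑ i, partialD i f p • (EuclideanSpace.proj i : Plane →L[ℝ] ℝ)) p := by
  convert hf.hasFDerivAt using 1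
  ext v
  rw [fderiv_apply_eq]
  simp [Fin.sum_univ_two, mul_comm]

theorem contDiffAt_of_partialD {f : Plane → ℝ} {p : Plane}
    (hd : ∀ᶠ q in 𝓝 p, DifferentiableAt ℝ f q) (h : ∀ i, ContDiffAt ℝ ∞ (partialD i f) p) :
    ContDiffAt ℝ ∞ f p := by
  rw [contDiffAt_infty]
  intro n
  suffices ContDiffAt ℝ ((n : ℕ) + 1) f p from this.of_le (by simp)
  rw [contDiffAt_succ_iff_hasFDerivAt]
  refine ⟨_, ⟨_, hd, fun q hq => hasFDerivAt_of_partialD hq⟩, ?_⟩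
  refine ContDiffAt.sum fun i _ => ContDiffAt.fun_smul ?_ contDiffAt_const
  exact contDiffAt_infty.1 (h i) n

end Calculus

/-! ### Gauss curvature at a critical point and of a graph. -/

section Curvature

variable {g : Plane → Matrix (Fin 2) (Fin 2) ℝ} {p : Plane}

theorem inv_fin_two_apply (M : Matrix (Fin 2) (Fin 2) ℝ) (k l : Fin 2) :
    M⁻¹ k l = (M 0 0 * M 1 1 - M 0 1 * M 1 0)⁻¹ * !![M 1 1, -M 0 1; -M 1 0, M 0 0] k l := by
  rw [Matrix.inv_def, Matrix.adjugate_fin_two, Matrix.det_fin_two, Ring.inverse_eq_inv']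
  rfl

theorem differentiableAt_inv_apply (hg : ∀ i j, DifferentiableAt ℝ (fun q => g q i j) p)
    (hdet : (g p).det ≠ 0) (k l : Fin 2) : DifferentiableAt ℝ (fun q => (g q)⁻¹ k l) p := by
  rw [Matrix.det_fin_two] at hdet
  have h00 := hg 0 0
  have h01 := hg 0 1
  have h10 := hg 1 0
  have h11 := hg 1 1
  simp only [inv_fin_two_apply]
  refine DifferentiableAt.fun_mul (DifferentiableAt.fun_inv (by fun_prop) hdet) ?_
  fin_cases k <;> fin_cases l <;> simp <;> fun_prop

/-- The Gauss curvature at a point where the metric agrees with the flat one to first order. -/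
theorem gaussCurvature_of_critical (hg : ∀ i j, ContDiffAt ℝ 2 (fun q => g q i j) p)
    (hsymm : ∀ᶠ q in 𝓝 p, g q 1 0 = g q 0 1) (hp : g p = 1)
    (hd : ∀ i j k, partialD k (fun q => g q i j) p = 0) :
    gaussCurvature g p = partialD 0 (partialD 1 fun q => g q 0 1) p -
      (1 / 2) * partialD 0 (partialD 0 fun q => g q 1 1) p -
      (1 / 2) * partialD 1 (partialD 1 fun q => g q 0 0) p := by
  have hD : ∀ i j k, DifferentiableAt ℝ (partialD k fun q => g q i j) p := fun i j k =>
    (ContDiffAt.partialD (n := 1) (by exact_mod_cast hg i j) k).differentiableAt (by simp)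
  have hinv : ∀ k l, DifferentiableAt ℝ (fun q => (g q)⁻¹ k l) p :=
    differentiableAt_inv_apply (fun i j => (hg i j).differentiableAt (by simp)) (by simp [hp])
  have h0 : ∀ k i j, christoffel g k i j p = 0 := by
    intro k i j
    simp [christoffel, hd]
  -- Derivatives of the inverse metric multiply first derivatives of `g`, which vanish at `p`.
  have h1 : ∀ m k i j, partialD m (christoffel g k i j) p = (1 / 2) *
      (partialD m (partialD i fun q => g q j k) p + partialD m (partialD j fun q => g q i k) p
        - partialD m (partialD k fun q => g q i j) p) := by
    intro m k i j
    have hA : ∀ l, DifferentiableAt ℝ (fun q => partialD i (fun q => g q j l) q +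
        partialD j (fun q => g q i l) q - partialD l (fun q => g q i j) q) p := fun l =>
      ((hD j l i).fun_add (hD i l j)).fun_sub (hD i j l)
    have hA' : ∀ l, partialD m (fun q => partialD i (fun q => g q j l) q +
        partialD j (fun q => g q i l) q - partialD l (fun q => g q i j) q) p =
        partialD m (partialD i fun q => g q j l) p + partialD m (partialD j fun q => g q i l) p
        - partialD m (partialD l fun q => g q i j) p := fun l => by
      rw [partialD_fun_sub ((hD j l i).fun_add (hD i l j)) (hD i j l),
        partialD_fun_add (hD j l i) (hD i l j)]
    have : christoffel g k i j = fun q => (1 / 2) *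
      ((g q)⁻¹ k 0 * (partialD i (fun q => g q j 0) q +
        partialD j (fun q => g q i 0) q - partialD 0 (fun q => g q i j) q) +
      (g q)⁻¹ k 1 * (partialD i (fun q => g q j 1) q +
        partialD j (fun q => g q i 1) q - partialD 1 (fun q => g q i j) q)) := by
      ext q
      rw [christoffel, Fin.sum_univ_two]
    rw [this, partialD_const_mul (((hinv k 0).fun_mul (hA 0)).fun_add ((hinv k 1).fun_mul (hA 1))),
      partialD_fun_add ((hinv k 0).fun_mul (hA 0)) ((hinv k 1).fun_mul (hA 1)),
      partialD_fun_mul (hinv k 0) (hA 0), partialD_fun_mul (hinv k 1) (hA 1), hA', hA']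
    fin_cases k <;> simp [hd, hp]
  have hs : ∀ i j, partialD i (partialD j fun q => g q 1 0) p =
      partialD i (partialD j fun q => g q 0 1) p := fun i j =>
    partialD_congr (partialD_eventuallyEq hsymm j) i
  simp only [gaussCurvature, riemannCurvature, h0, h1, Fin.sum_univ_two, hp, hs]
  rw [partialD_comm (hg 0 1) 1 0]
  simp
  ring

variable {u : Plane → ℝ}

/-- The Gauss curvature of a graph. -/
theorem gaussCurvature_of_graph (hu : ContDiffAt ℝ 3 u p)
    (hg : ∀ᶠ q in 𝓝 p, ∀ i j, g q i j = (if i = j then 1 else 0) + partialD i u q * partialD j u q) :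
    gaussCurvature g p =
      (partialD 0 (partialD 0 u) p * partialD 1 (partialD 1 u) p -
        partialD 0 (partialD 1 u) p ^ 2) / (1 + partialD 0 u p ^ 2 + partialD 1 u p ^ 2) ^ 2 := by
  have ha2 : ∀ i, ContDiffAt ℝ 2 (partialD i u) p := fun i =>
    ContDiffAt.partialD (n := 2) (by exact_mod_cast hu) i
  have ha : ∀ i, ∀ᶠ q in 𝓝 p, DifferentiableAt ℝ (partialD i u) q := fun i =>
    ((ha2 i).eventually (by simp)).mono fun q hq => hq.differentiableAt (by simp)
  have hu2 : ∀ᶠ q in 𝓝 p, ContDiffAt ℝ 2 u q :=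
    (hu.of_le (by norm_num)).eventually (by simp)
  have hh : ∀ i j, DifferentiableAt ℝ (partialD i (partialD j u)) p := fun i j =>
    (ContDiffAt.partialD (n := 1) (by exact_mod_cast ha2 j) i).differentiableAt (by simp)
  have hW : ∀ q, 0 < 1 + partialD 0 u q ^ 2 + partialD 1 u q ^ 2 := fun q => by positivity
  have hdg : ∀ᶠ q in 𝓝 p, ∀ i j k, partialD k (fun q => g q i j) q =
      partialD i u q * partialD k (partialD j u) q +
        partialD j u q * partialD k (partialD i u) q := by
    filter_upwards [hg.eventually_nhds, ha 0, ha 1] with q hq h0 h1 i j k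
    have hd : ∀ i, DifferentiableAt ℝ (partialD i u) q := by
      intro i; fin_cases i <;> assumption
    rw [partialD_congr (hq.mono fun z hz => hz i j) k,
      partialD_fun_add (differentiableAt_const _) ((hd i).fun_mul (hd j)),
      partialD_fun_mul (hd i) (hd j)]
    simp [partialD]
  -- For a graph, `Γ^k_ij = u_k u_ij / (1 + |∇u|²)`.
  have hΓ : ∀ k i j, christoffel g k i j =ᶠ[𝓝 p] fun q =>
      (1 + partialD 0 u q ^ 2 + partialD 1 u q ^ 2)⁻¹ *
        (partialD k u q * partialD i (partialD j u) q) := by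
    intro k i j
    filter_upwards [hg, hdg, hu2] with q hq hdq h2
    have hne := (hW q).ne'
    have hs := partialD_comm h2 0 1
    have hdet : g q 0 0 * g q 1 1 - g q 0 1 * g q 1 0 =
        1 + partialD 0 u q ^ 2 + partialD 1 u q ^ 2 := by
      simp only [hq]; simp; ring
    rw [christoffel, Fin.sum_univ_two, inv_fin_two_apply, inv_fin_two_apply, hdet]
    simp only [hdq, hq]
    fin_cases k <;> fin_cases i <;> fin_cases j <;> simp [hs] <;> ring
  have hWd : DifferentiableAt ℝ (fun q => 1 + partialD 0 u q ^ 2 + partialD 1 u q ^ 2) p := by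
    have h0 := (ha 0).self_of_nhds
    have h1 := (ha 1).self_of_nhds
    fun_prop
  have hWd' : ∀ i, partialD i (fun q => 1 + partialD 0 u q ^ 2 + partialD 1 u q ^ 2) p =
      2 * partialD 0 u p * partialD i (partialD 0 u) p +
        2 * partialD 1 u p * partialD i (partialD 1 u) p := by
    intro i
    have h0 := (ha 0).self_of_nhds
    have h1 := (ha 1).self_of_nhds
    rw [partialD_fun_add (by fun_prop) (by fun_prop), partialD_fun_add (by fun_prop) (by fun_prop)]
    simp only [pow_two]
    rw [partialD_fun_mul h0 h0, partialD_fun_mul h1 h1]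
    simp [partialD]
    ring
  have hΓd : ∀ m k i j, partialD m (christoffel g k i j) p = _ := fun m k i j => by
    have hk := (ha k).self_of_nhds
    rw [partialD_congr (hΓ k i j) m, partialD_fun_mul (hWd.fun_inv (hW p).ne')
      (hk.fun_mul (hh i j)), partialD_fun_mul hk (hh i j), partialD_fun_inv hWd (hW p).ne', hWd']
  have hdet : (g p).det = 1 + partialD 0 u p ^ 2 + partialD 1 u p ^ 2 := by
    rw [Matrix.det_fin_two]
    simp only [hg.self_of_nhds]; simp; ring
  have hΓp : ∀ k i j, christoffel g k i j p = _ := fun k i j => (hΓ k i j).self_of_nhds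
  have hs := partialD_comm hu2.self_of_nhds 0 1
  have h3 := partialD_comm (ha2 1) 0 1
  -- Symmetry of the third derivatives is what cancels them in the curvature.
  have h4 : partialD 1 (partialD 1 (partialD 0 u)) p = partialD 1 (partialD 0 (partialD 1 u)) p :=
    partialD_congr (hu2.mono fun q hq => (partialD_comm hq 1 0)) 1
  have hne := (hW p).ne'
  simp only [gaussCurvature, riemannCurvature, Fin.sum_univ_two, hdet, hΓd, hΓp,
    hg.self_of_nhds]
  rw [← hs, h3]
  simp
  field_simp
  ring

end Curvature

/-! ### Regularity at an isolated nondegenerate critical point. -/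

section Local

/-- Continuity fixes the sign of `a k` near `p`, so `a k = ±√(a k ²)`; the others are `a i * a k / a
k`. -/
theorem contDiffAt_of_mul_of_ne_zero {ι E : Type} [NormedAddCommGroup E] [NormedSpace ℝ E]
    {a : ι → E → ℝ} {p : E} (h : ∀ i j, ContDiffAt ℝ ∞ (fun q => a i q * a j q) p) {k : ι}
    (hc : ContinuousAt (a k) p) (hk : a k p ≠ 0) (i : ι) : ContDiffAt ℝ ∞ (a i) p := by
  have hsq : ContDiffAt ℝ ∞ (fun q => √(a k q * a k q)) p :=
    (h k k).sqrt (mul_self_ne_zero.2 hk)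
  have hak : ContDiffAt ℝ ∞ (a k) p := by
    rcases lt_or_gt_of_ne hk with hneg | hpos
    · refine hsq.neg.congr_of_eventuallyEq ?_
      filter_upwards [hc.eventually (gt_mem_nhds hneg)] with q hq
      simp [Real.sqrt_mul_self_eq_abs, abs_of_neg hq]
    · refine hsq.congr_of_eventuallyEq ?_
      filter_upwards [hc.eventually (lt_mem_nhds hpos)] with q hq
      simp [Real.sqrt_mul_self_eq_abs, abs_of_pos hq]
  refine ((h i k).div hak hk).congr_of_eventuallyEq ?_
  filter_upwards [hc.eventually_ne hk] with q hq
  simp [hq]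

/-- Polar coordinates: the image of sphere times interval. -/
theorem isPreconnected_ball_diff_center {E : Type} [NormedAddCommGroup E] [NormedSpace ℝ E]
    (h : 1 < Module.rank ℝ E) (p : E) (ε : ℝ) : IsPreconnected (Metric.ball p ε \ {p}) := by
  have hpre : IsPreconnected (Metric.sphere (0 : E) 1 ×ˢ Set.Ioo 0 ε) :=
    (isPreconnected_sphere h 0 1).prod isPreconnected_Ioo
  have : Metric.ball p ε \ {p} =
      (fun y : E × ℝ => p + y.2 • y.1) '' (Metric.sphere (0 : E) 1 ×ˢ Set.Ioo 0 ε) := by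
    ext q
    constructor
    · rintro ⟨hq, hqp⟩
      have hn : 0 < ‖q - p‖ := norm_pos_iff.2 (sub_ne_zero.2 hqp)
      refine ⟨(‖q - p‖⁻¹ • (q - p), ‖q - p‖), ⟨?_, hn, by simpa [dist_eq_norm] using hq⟩, ?_⟩
      · simp [norm_smul, hn.ne']
      · simp [smul_smul, hn.ne']
    · rintro ⟨⟨x, t⟩, ⟨hx, ht0, htε⟩, rfl⟩
      simp only [mem_sphere_iff_norm, sub_zero] at hx
      simp only at ht0 htε
      refine ⟨by simpa [norm_smul, hx, abs_of_pos ht0] using htε, ?_⟩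
      have : t • x ≠ 0 := smul_ne_zero ht0.ne' (by rintro rfl; simp at hx)
      simpa using this
  rw [this]
  exact hpre.image _ (by fun_prop)

theorem one_lt_rank_plane : 1 < Module.rank ℝ Plane := by
  rw [← Module.finrank_eq_rank, finrank_euclideanSpace_fin]
  norm_num

/-- A continuous nonvanishing function on a punctured neighbourhood in the plane has a sign. -/
theorem exists_sign_of_eventually_ne_zero {f : Plane → ℝ} {p : Plane}
    (hc : ∀ᶠ q in 𝓝[≠] p, ContinuousAt f q) (h0 : ∀ᶠ q in 𝓝[≠] p, f q ≠ 0) :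
    ∃ σ : ℝ, σ ^ 2 = 1 ∧ ∀ᶠ q in 𝓝[≠] p, 0 < σ * f q := by
  obtain ⟨ε, hε, hball⟩ := Metric.mem_nhdsWithin_iff.1 (hc.and h0)
  have hpre := isPreconnected_ball_diff_center one_lt_rank_plane p ε
  have hmem : Metric.ball p ε \ {p} ∈ 𝓝[≠] p :=
    Metric.mem_nhdsWithin_iff.2 ⟨ε, hε, subset_rfl⟩
  have hpre' : IsPreconnected (f '' (Metric.ball p ε \ {p})) :=
    hpre.image _ fun q hq => (hball hq).1.continuousWithinAt
  have hoc := hpre'.ordConnected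
  by_cases hneg : ∃ q ∈ Metric.ball p ε \ {p}, f q < 0
  · obtain ⟨q, hq, hqn⟩ := hneg
    refine ⟨-1, by norm_num, ?_⟩
    filter_upwards [hmem] with z hz
    by_contra! hcon
    obtain ⟨w, hw, hw0⟩ := hoc.out ⟨q, hq, rfl⟩ ⟨z, hz, rfl⟩
      (⟨hqn.le, by linarith⟩ : (0 : ℝ) ∈ Set.Icc (f q) (f z))
    exact (hball hw).2 hw0
  · push Not at hneg
    refine ⟨1, by norm_num, ?_⟩
    filter_upwards [hmem] with z hz
    rw [one_mul]
    exact lt_of_le_of_ne (hneg z hz) (Ne.symm (hball hz).2)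

theorem eq_zero_of_forall_add_nonneg {b c : ℝ} (h : ∀ τ : ℝ, 0 ≤ b * τ + c * τ ^ 2) : b = 0 := by
  by_contra hb
  have hc : 0 < |c| + 1 := by positivity
  -- With this `τ` the linear term beats the quadratic one, whatever the sign of `c`.
  have h1 := h (-b / (|c| + 1))
  have h2 : b * (-b / (|c| + 1)) + c * (-b / (|c| + 1)) ^ 2 =
      b ^ 2 / (|c| + 1) ^ 2 * (c - (|c| + 1)) := by field_simp; ring
  rw [h2] at h1
  have h3 : 0 < b ^ 2 / (|c| + 1) ^ 2 := by positivity
  nlinarith [le_abs_self c]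

/-- An isotropic vector minimises the form, so the gradient vanishes there. -/
theorem kernel_of_nonneg_form {a b c x y : ℝ}
    (h : ∀ x y : ℝ, 0 ≤ x ^ 2 * a + 2 * x * y * b + y ^ 2 * c)
    (h0 : x ^ 2 * a + 2 * x * y * b + y ^ 2 * c = 0) : x * a + y * b = 0 ∧ x * b + y * c = 0 := by
  constructor
  · have := eq_zero_of_forall_add_nonneg (b := 2 * (x * a + y * b)) (c := a) fun τ => by
      have := h (x + τ) y
      linarith
    linarith
  · have := eq_zero_of_forall_add_nonneg (b := 2 * (x * b + y * c)) (c := c) fun τ => by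
      have := h x (y + τ)
      linarith
    linarith

/-! ### Nonnegative biquadratic forms. -/

section Forms

variable {A₀ A₁ A₂ B₀ B₁ B₂ C₀ C₁ C₂ : ℝ}

/-- `A`, `B`, `C` stand for the Hessians of `a 0 ²`, `a 0 * a 1`, `a 1 ²`, and `hK` says that the
curvature `B₁ - (A₂ + C₀) / 2` is positive. If `A₀ = C₂ = 0`, the kernel argument kills `A₁`, `C₁`,
`B₀`, `B₂`; then `A₂, C₀ ≥ 0` and `A₂ + C₀ ≥ 4 B₁` contradict `hK`. -/
theorem nonneg_left_of_nonneg_forms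
    (h : ∀ s t x y : ℝ, 0 ≤ x ^ 2 * (s ^ 2 * A₀ + 2 * s * t * B₀ + t ^ 2 * C₀) +
      2 * x * y * (s ^ 2 * A₁ + 2 * s * t * B₁ + t ^ 2 * C₁) +
      y ^ 2 * (s ^ 2 * A₂ + 2 * s * t * B₂ + t ^ 2 * C₂)) (hK : A₂ + C₀ - 2 * B₁ < 0) :
    A₀ ≠ 0 ∨ C₂ ≠ 0 := by
  by_contra! hcon
  obtain ⟨hA, hC⟩ := hcon
  have hA1 := (kernel_of_nonneg_form (a := A₀) (b := A₁) (c := A₂) (x := 1) (y := 0)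
    (fun x y => by have := h 1 0 x y; linarith) (by simp [hA])).2
  have hC1 := (kernel_of_nonneg_form (a := C₀) (b := C₁) (c := C₂) (x := 0) (y := 1)
    (fun x y => by have := h 0 1 x y; linarith) (by simp [hC])).1
  have hB0 := (kernel_of_nonneg_form (a := A₀) (b := B₀) (c := C₀) (x := 1) (y := 0)
    (fun x y => by have := h x y 1 0; linarith) (by simp [hA])).2
  have hB2 := (kernel_of_nonneg_form (a := A₂) (b := B₂) (c := C₂) (x := 0) (y := 1)
    (fun x y => by have := h x y 0 1; linarith) (by simp [hC])).1
  have h1 := h 1 1 1 (-1)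
  have h2 := h 1 0 0 1
  have h3 := h 0 1 1 0
  simp only [one_mul, zero_mul, add_zero, zero_add] at hA1 hC1 hB0 hB2
  subst hA hC hA1 hC1 hB0 hB2
  linarith

/-- A null vector of `A + C` is isotropic for `A`, `C` and `A ± 2B + C`, hence lies in the kernels
of `A`, `B`, `C`. Testing with `(s, t) = (x, y)` in the orthogonal direction `(-y, x)` then leaves
only the curvature term, of the wrong sign. -/
theorem eq_zero_of_nonneg_forms
    (h : ∀ s t x y : ℝ, 0 ≤ x ^ 2 * (s ^ 2 * A₀ + 2 * s * t * B₀ + t ^ 2 * C₀) +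
      2 * x * y * (s ^ 2 * A₁ + 2 * s * t * B₁ + t ^ 2 * C₁) +
      y ^ 2 * (s ^ 2 * A₂ + 2 * s * t * B₂ + t ^ 2 * C₂)) (hK : A₂ + C₀ - 2 * B₁ < 0)
    {x y : ℝ} (h0 : x ^ 2 * (A₀ + C₀) + 2 * x * y * (A₁ + C₁) + y ^ 2 * (A₂ + C₂) = 0) :
    x = 0 ∧ y = 0 := by
  by_contra hcon
  have hpos : 0 < x ^ 2 + y ^ 2 := by
    by_contra! hle
    exact hcon ⟨by nlinarith [sq_nonneg x, sq_nonneg y], by nlinarith [sq_nonneg x, sq_nonneg y]⟩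
  have hA : ∀ x y : ℝ, 0 ≤ x ^ 2 * A₀ + 2 * x * y * A₁ + y ^ 2 * A₂ := fun x y => by
    have := h 1 0 x y; linarith
  have hC : ∀ x y : ℝ, 0 ≤ x ^ 2 * C₀ + 2 * x * y * C₁ + y ^ 2 * C₂ := fun x y => by
    have := h 0 1 x y; linarith
  have hS : ∀ x y : ℝ, 0 ≤ x ^ 2 * (A₀ + 2 * B₀ + C₀) + 2 * x * y * (A₁ + 2 * B₁ + C₁) +
      y ^ 2 * (A₂ + 2 * B₂ + C₂) := fun x y => by
    have := h 1 1 x y; linarith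
  have hA0 : x ^ 2 * A₀ + 2 * x * y * A₁ + y ^ 2 * A₂ = 0 := by linarith [hA x y, hC x y]
  have hC0 : x ^ 2 * C₀ + 2 * x * y * C₁ + y ^ 2 * C₂ = 0 := by linarith [hA x y, hC x y]
  have hB0 : x ^ 2 * (A₀ + 2 * B₀ + C₀) + 2 * x * y * (A₁ + 2 * B₁ + C₁) +
      y ^ 2 * (A₂ + 2 * B₂ + C₂) = 0 := by linarith [hS x y, h 1 (-1) x y]
  obtain ⟨a1, a2⟩ := kernel_of_nonneg_form hA hA0
  obtain ⟨c1, c2⟩ := kernel_of_nonneg_form hC hC0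
  obtain ⟨s1, s2⟩ := kernel_of_nonneg_form hS hB0
  have b1 : x * B₀ + y * B₁ = 0 := by linarith
  have b2 : x * B₁ + y * B₂ = 0 := by linarith
  have key := h x y (-y) x
  have : (-y) ^ 2 * (x ^ 2 * A₀ + 2 * x * y * B₀ + y ^ 2 * C₀) +
      2 * (-y) * x * (x ^ 2 * A₁ + 2 * x * y * B₁ + y ^ 2 * C₁) +
      x ^ 2 * (x ^ 2 * A₂ + 2 * x * y * B₂ + y ^ 2 * C₂) =
      (x ^ 2 + y ^ 2) ^ 2 * (A₂ + C₀ - 2 * B₁) := by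
    linear_combination (y ^ 2 * x) * a1 + (-2 * x ^ 2 * y - y ^ 3) * a2 +
      (-2 * x * y ^ 2 - x ^ 3) * c1 + (x ^ 2 * y) * c2 +
      2 * (y ^ 3) * b1 + 2 * (x ^ 3) * b2
  rw [this] at key
  have := mul_neg_of_pos_of_neg (by positivity : 0 < (x ^ 2 + y ^ 2) ^ 2) hK
  linarith

end Forms

theorem partialD_partialD_add_add {f₁ f₂ f₃ : Plane → ℝ} {p : Plane} (h₁ : ContDiffAt ℝ 2 f₁ p)
    (h₂ : ContDiffAt ℝ 2 f₂ p) (h₃ : ContDiffAt ℝ 2 f₃ p) (c₁ c₂ c₃ : ℝ) (i j : Fin 2) :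
    partialD i (partialD j fun q => c₁ * f₁ q + c₂ * f₂ q + c₃ * f₃ q) p =
      c₁ * partialD i (partialD j f₁) p + c₂ * partialD i (partialD j f₂) p +
        c₃ * partialD i (partialD j f₃) p := by
  have hd : ∀ f : Plane → ℝ, ContDiffAt ℝ 2 f p → (∀ᶠ q in 𝓝 p, DifferentiableAt ℝ f q) ∧
      DifferentiableAt ℝ (partialD j f) p := fun f hf =>
    ⟨(hf.eventually (by simp)).mono fun q hq => hq.differentiableAt (by simp),
      (ContDiffAt.partialD (n := 1) (by exact_mod_cast hf) j).differentiableAt (by simp)⟩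
  obtain ⟨e1, d1⟩ := hd _ h₁
  obtain ⟨e2, d2⟩ := hd _ h₂
  obtain ⟨e3, d3⟩ := hd _ h₃
  have : partialD j (fun q => c₁ * f₁ q + c₂ * f₂ q + c₃ * f₃ q) =ᶠ[𝓝 p] fun q =>
      c₁ * partialD j f₁ q + c₂ * partialD j f₂ q + c₃ * partialD j f₃ q := by
    filter_upwards [e1, e2, e3] with q h1 h2 h3
    rw [partialD_fun_add (by fun_prop) (by fun_prop), partialD_fun_add (by fun_prop) (by fun_prop),
      partialD_const_mul h1, partialD_const_mul h2, partialD_const_mul h3]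
  rw [partialD_congr this, partialD_fun_add (by fun_prop) (by fun_prop),
    partialD_fun_add (by fun_prop) (by fun_prop),
    partialD_const_mul d1, partialD_const_mul d2, partialD_const_mul d3]

/-! ### Hessians of products at a common zero. -/

section Products

variable {a : Fin 2 → Plane → ℝ} {p : Plane}

/-- The Hessians at a common zero of the squares of the linear combinations of `a 0` and `a 1` are
nonnegative. -/
theorem hessian_forms_nonneg (hF : ∀ i j, ContDiffAt ℝ 2 (fun q => a i q * a j q) p)
    (h0 : ∀ i, a i p = 0) (s t x y : ℝ) :
    0 ≤ x ^ 2 * (s ^ 2 * partialD 0 (partialD 0 fun q => a 0 q * a 0 q) p +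
        2 * s * t * partialD 0 (partialD 0 fun q => a 0 q * a 1 q) p +
        t ^ 2 * partialD 0 (partialD 0 fun q => a 1 q * a 1 q) p) +
      2 * x * y * (s ^ 2 * partialD 0 (partialD 1 fun q => a 0 q * a 0 q) p +
        2 * s * t * partialD 0 (partialD 1 fun q => a 0 q * a 1 q) p +
        t ^ 2 * partialD 0 (partialD 1 fun q => a 1 q * a 1 q) p) +
      y ^ 2 * (s ^ 2 * partialD 1 (partialD 1 fun q => a 0 q * a 0 q) p +
        2 * s * t * partialD 1 (partialD 1 fun q => a 0 q * a 1 q) p +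
        t ^ 2 * partialD 1 (partialD 1 fun q => a 1 q * a 1 q) p) := by
  have hf : ContDiffAt ℝ 2 (fun q => s ^ 2 * (a 0 q * a 0 q) + 2 * s * t * (a 0 q * a 1 q) +
      t ^ 2 * (a 1 q * a 1 q)) p :=
    ((contDiffAt_const.mul (hF 0 0)).add (contDiffAt_const.mul (hF 0 1))).add
      (contDiffAt_const.mul (hF 1 1))
  have hmin : IsLocalMin (fun q => s ^ 2 * (a 0 q * a 0 q) + 2 * s * t * (a 0 q * a 1 q) +
      t ^ 2 * (a 1 q * a 1 q)) p := Eventually.of_forall fun q => by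
    simp only [h0]
    nlinarith [sq_nonneg (s * a 0 q + t * a 1 q)]
  have := hmin.fderiv_fderiv_nonneg hf !₂[x, y]
  rw [fderiv_fderiv_apply_self hf] at this
  simp only [partialD_partialD_add_add (hF 0 0) (hF 0 1) (hF 1 1)] at this
  simpa using this

/-- A nondegeneracy condition under which a common zero of `a 0` and `a 1` is isolated. -/
theorem eventually_exists_ne_zero (hF : ∀ i j, ContDiffAt ℝ 2 (fun q => a i q * a j q) p)
    (h0 : ∀ i, a i p = 0)
    (hK : partialD 1 (partialD 1 fun q => a 0 q * a 0 q) p +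
      partialD 0 (partialD 0 fun q => a 1 q * a 1 q) p -
      2 * partialD 0 (partialD 1 fun q => a 0 q * a 1 q) p < 0) :
    ∀ᶠ q in 𝓝[≠] p, ∃ i, a i q ≠ 0 := by
  set f : Plane → ℝ := fun q => 1 * (a 0 q * a 0 q) + 0 * (a 0 q * a 1 q) + 1 * (a 1 q * a 1 q)
    with hf
  have hfc : ContDiffAt ℝ 2 f p :=
    ((contDiffAt_const.mul (hF 0 0)).add (contDiffAt_const.mul (hF 0 1))).add
      (contDiffAt_const.mul (hF 1 1))
  have hfd : HasFDerivAt (fderiv ℝ f) (fderiv ℝ (fderiv ℝ f) p) p :=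
    ((hfc.fderiv_right (m := 1) (by norm_num)).differentiableAt (by simp)).hasFDerivAt
  have hker : LinearMap.ker (fderiv ℝ (fderiv ℝ f) p : Plane →ₗ[ℝ] Plane →L[ℝ] ℝ) = ⊥ := by
    rw [LinearMap.ker_eq_bot']
    intro v hv
    have hv' : fderiv ℝ (fderiv ℝ f) p v = 0 := hv
    have h1 := fderiv_fderiv_apply_self hfc v
    rw [fderiv_fderiv_apply hfc, hv'] at h1
    simp only [hf, partialD_partialD_add_add (hF 0 0) (hF 0 1) (hF 1 1)] at h1
    obtain ⟨hx, hy⟩ := eq_zero_of_nonneg_forms (hessian_forms_nonneg hF h0) hK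
      (x := v 0) (y := v 1) (by simpa using h1.symm)
    rw [plane_eq v, hx, hy]
    simp
  -- An injective Hessian keeps the gradient of `f` nonzero off `p`, whereas every common zero is a
  -- minimum of `f`.
  obtain ⟨K, -, hanti⟩ := LinearMap.exists_antilipschitzWith _ hker
  filter_upwards [hfd.eventually_ne (c := 0) ⟨K, hanti⟩] with q hq
  by_contra! hcon
  apply hq
  refine IsLocalMin.fderiv_eq_zero (Eventually.of_forall fun z => ?_)
  simp only [hf, hcon]
  nlinarith [sq_nonneg (a 0 z), sq_nonneg (a 1 z)]

end Products

/-- A positive determinant forbids `u_ii = 0` off `p`, so `u_ii` has one sign on a punctured disc;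
this is the monotonicity that `contDiffAt_of_sq_of_mul` needs for `a = u_i`, `b = u_j`. -/
theorem contDiffAt_partialD_of_critical {u : Plane → ℝ} {p : Plane}
    (hc : ∀ i, ∀ᶠ q in 𝓝 p, ContinuousAt (partialD i u) q)
    (hF : ∀ i j, ContDiffAt ℝ ∞ (fun q => partialD i u q * partialD j u q) p)
    (h0 : ∀ i, partialD i u p = 0) (hsm : ∀ᶠ q in 𝓝[≠] p, ContDiffAt ℝ ∞ u q)
    (hdet : ∀ᶠ q in 𝓝[≠] p, 0 < partialD 0 (partialD 0 u) q * partialD 1 (partialD 1 u) q -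
      partialD 0 (partialD 1 u) q ^ 2)
    (hnd : ∃ i, partialD i (partialD i fun q => partialD i u q * partialD i u q) p ≠ 0) :
    ∀ i, ContDiffAt ℝ ∞ (partialD i u) p := by
  obtain ⟨i, hi⟩ := hnd
  have hsm' : ∀ (n : ℕ), ∀ᶠ q in 𝓝[≠] p, ContDiffAt ℝ n (partialD i u) q := fun n =>
    hsm.mono fun q hq => ContDiffAt.partialD (n := n) (hq.of_le (mod_cast le_top)) i
  obtain ⟨σ, hσ, hsign⟩ := exists_sign_of_eventually_ne_zero (f := partialD i (partialD i u)) (p := p)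
    ((hsm' (1 + 1)).mono fun q hq => (ContDiffAt.partialD (n := 1) hq i).continuousAt)
    (hdet.mono fun q hq h => by
      have : partialD 0 (partialD 0 u) q * partialD 1 (partialD 1 u) q = 0 := by
        fin_cases i
        · exact mul_eq_zero_of_left h _
        · exact mul_eq_zero_of_right _ h
      nlinarith [sq_nonneg (partialD 0 (partialD 1 u) q)])
  intro j
  have hsq : (fun q => partialD i u q * partialD i u q) = fun q => partialD i u q ^ 2 :=
    funext fun q => (sq _).symm
  have hFi := hF i i
  rw [hsq] at hi hFi
  exact (contDiffAt_of_sq_of_mul hσ hFi (hF i j) (hc j) (h0 i)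
    ((hsm' 1).mono fun q hq => hq.differentiableAt (by simp)) hsign hi).2

end Local

/-! ### Convexity and comparison with a paraboloid. -/

section MaximumPrinciple

theorem abs_sub_le_mul_sq_of_abs_deriv_le {f f' : ℝ → ℝ} {c : ℝ} (hc : 0 ≤ c)
    (hf : ∀ᶠ t in 𝓝 0, HasDerivAt f (f' t) t) (hb : ∀ᶠ t in 𝓝 0, |f' t| ≤ c * |t|) :
    ∀ᶠ t in 𝓝 0, |f t - f 0| ≤ c * t ^ 2 := by
  obtain ⟨δ, hδ, h⟩ := Metric.eventually_nhds_iff_ball.1 (hf.and hb)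
  filter_upwards [Metric.ball_mem_nhds (0 : ℝ) hδ] with t ht
  have hsub : ∀ s ∈ Metric.closedBall (0 : ℝ) |t|, s ∈ Metric.ball (0 : ℝ) δ := fun s hs => by
    simp only [Metric.mem_closedBall, dist_zero_right, Real.norm_eq_abs, Metric.mem_ball] at *
    linarith
  have := (convex_closedBall (0 : ℝ) |t|).norm_image_sub_le_of_norm_hasDerivWithin_le (f := f)
    (f' := f') (C := c * |t|) (x := 0) (y := t)
    (fun s hs => (h s (hsub s hs)).1.hasDerivWithinAt)
    (fun s hs => ((h s (hsub s hs)).2).trans (by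
      simp only [Metric.mem_closedBall, dist_zero_right, Real.norm_eq_abs] at hs
      gcongr)) (by simp) (by simp)
  simp only [sub_zero, Real.norm_eq_abs] at this
  rwa [mul_assoc, ← abs_mul, ← sq, abs_of_nonneg (sq_nonneg t)] at this

/-- If the second derivative in a direction of the square of the corresponding derivative of `u`
vanishes at a zero, then `u` vanishes there to order more than two in this direction. -/
theorem abs_sub_le_mul_sq_of_degenerate {u : Plane → ℝ} {p : Plane} {i : Fin 2}
    (hd : ∀ᶠ q in 𝓝 p, DifferentiableAt ℝ u q)
    (hF : ContDiffAt ℝ 2 (fun q => partialD i u q * partialD i u q) p) (h0 : partialD i u p = 0)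
    (hdeg : partialD i (partialD i fun q => partialD i u q * partialD i u q) p = 0)
    {ε : ℝ} (hε : 0 < ε) :
    ∀ᶠ t in 𝓝 (0 : ℝ), |u (p + t • EuclideanSpace.single i 1) - u p| ≤ ε * t ^ 2 := by
  set v : Plane := EuclideanSpace.single i 1 with hv
  set F : Plane → ℝ := fun q => partialD i u q * partialD i u q with hFdef
  have ht : Tendsto (fun t : ℝ => p + t • v) (𝓝 0) (𝓝 p) := by
    have : ContinuousAt (fun t : ℝ => p + t • v) 0 := by fun_prop
    simpa [ContinuousAt] using this
  have hF0 : ContDiffAt ℝ 2 F (p + (0 : ℝ) • v) := by simpa using hF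
  have hφ : ∀ᶠ t in 𝓝 (0 : ℝ), HasDerivAt (fun t : ℝ => F (p + t • v))
      (deriv (fun t : ℝ => F (p + t • v)) t) t := by
    filter_upwards [ht.eventually (hF.eventually (by simp))] with t ht
    have := DifferentiableAt.hasDerivAt_line (ht.differentiableAt (by simp))
    rwa [this.deriv]
  have hmin : IsLocalMin (fun t : ℝ => F (p + t • v)) 0 := Eventually.of_forall fun t => by
    simp only [hFdef, zero_smul, add_zero, h0, mul_zero]
    exact mul_self_nonneg _
  have h1 : deriv (fun t : ℝ => F (p + t • v)) 0 = 0 := hmin.deriv_eq_zero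
  have h2 : HasDerivAt (deriv fun t : ℝ => F (p + t • v)) 0 0 := by
    have := hF0.hasDerivAt_deriv_line
    rw [zero_smul, add_zero] at this
    exact hdeg ▸ this
  -- The square anticipates the root: `F' = o(t)` gives `u_i² = o(t²)`, so `u_i = o(t)` and `u - u p
  -- = o(t²)`.
  have h3 : ∀ᶠ t in 𝓝 (0 : ℝ), |deriv (fun t : ℝ => F (p + t • v)) t| ≤ ε ^ 2 * |t| := by
    have := (hasDerivAt_iff_isLittleO.1 h2).def (by positivity : 0 < ε ^ 2)
    simpa [h1] using this
  have h4 := abs_sub_le_mul_sq_of_abs_deriv_le (by positivity) hφ h3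
  refine (abs_sub_le_mul_sq_of_abs_deriv_le (f := fun t : ℝ => u (p + t • v))
    (f' := fun t => partialD i u (p + t • v)) hε.le ?_ ?_).mono fun t ht => by simpa using ht
  · filter_upwards [ht.eventually hd] with t ht
    exact DifferentiableAt.hasDerivAt_line ht
  · filter_upwards [h4] with t ht
    simp only [hFdef, zero_smul, add_zero, h0, mul_zero, sub_zero] at ht
    rw [abs_of_nonneg (mul_self_nonneg _)] at ht
    refine abs_le_of_sq_le_sq ?_ (by positivity)
    rw [mul_pow, sq_abs]
    linarith

/-- Nothing is known of second derivatives at `p`, so the open segment has to avoid it; `u` is then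
convex along the segment. -/
theorem midpoint_le_of_hessian_nonneg {u : Plane → ℝ} {p : Plane} {ρ : ℝ}
    (hc : ∀ q ∈ Metric.ball p ρ, ContinuousAt u q)
    (hsm : ∀ q ∈ Metric.ball p ρ, q ≠ p → ContDiffAt ℝ 2 u q)
    (hH : ∀ q ∈ Metric.ball p ρ, q ≠ p → ∀ v, 0 ≤ fderiv ℝ (fun z => fderiv ℝ u z v) q v)
    {P Q : Plane} (hP : P ∈ Metric.ball p ρ) (hQ : Q ∈ Metric.ball p ρ)
    (hne : ∀ t ∈ Set.Ioo (0 : ℝ) 1, P + t • (Q - P) ≠ p) :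
    u (P + (1 / 2 : ℝ) • (Q - P)) ≤ (u P + u Q) / 2 := by
  have hmem : ∀ t ∈ Set.Icc (0 : ℝ) 1, P + t • (Q - P) ∈ Metric.ball p ρ := fun t ht =>
    (convex_ball p ρ).add_smul_sub_mem hP hQ ht
  have hcd : ∀ t ∈ Set.Ioo (0 : ℝ) 1, ContDiffAt ℝ 2 u (P + t • (Q - P)) := fun t ht =>
    hsm _ (hmem t (Set.Ioo_subset_Icc_self ht)) (hne t ht)
  have hconv : ConvexOn ℝ (Set.Icc (0 : ℝ) 1) fun t : ℝ => u (P + t • (Q - P)) := by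
    apply convexOn_of_deriv2_nonneg (convex_Icc 0 1)
    · intro t ht
      exact (ContinuousAt.comp (f := fun t : ℝ => P + t • (Q - P)) (hc _ (hmem t ht))
        (by fun_prop)).continuousWithinAt
    · rw [interior_Icc]
      exact fun t ht => (DifferentiableAt.hasDerivAt_line ((hcd t ht).differentiableAt
        (by simp))).differentiableAt.differentiableWithinAt
    · rw [interior_Icc]
      exact fun t ht => (hcd t ht).hasDerivAt_deriv_line.differentiableAt.differentiableWithinAt
    · rw [interior_Icc]
      intro t ht
      simp only [Function.iterate_succ, Function.iterate_zero, Function.comp_apply, id]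
      rw [(hcd t ht).hasDerivAt_deriv_line.deriv]
      exact hH _ (hmem t (Set.Ioo_subset_Icc_self ht)) (hne t ht) _
  have := hconv.2 (Set.left_mem_Icc.2 zero_le_one) (Set.right_mem_Icc.2 zero_le_one)
    (by norm_num : (0 : ℝ) ≤ 1 / 2) (by norm_num : (0 : ℝ) ≤ 1 / 2) (by norm_num)
  simp only [smul_eq_mul, mul_zero, mul_one, zero_add, zero_smul, add_zero, one_smul,
    add_sub_cancel] at this
  linarith

theorem norm_sq_plane (z : Plane) : ‖z‖ ^ 2 = z 0 ^ 2 + z 1 ^ 2 := by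
  rw [EuclideanSpace.norm_sq_eq, Fin.sum_univ_two]
  simp

theorem partialD_coord (i j : Fin 2) (q : Plane) :
    partialD i (fun z => z j) q = if i = j then 1 else 0 := by
  have : fderiv ℝ (fun z : Plane => z j) q = (EuclideanSpace.proj j : Plane →L[ℝ] ℝ) :=
    (EuclideanSpace.proj j : Plane →L[ℝ] ℝ).hasFDerivAt.fderiv
  rw [partialD, this]
  simp [eq_comm]

theorem partialD_norm_sub_sq (i : Fin 2) (p : Plane) :
    partialD i (fun z => ‖z - p‖ ^ 2) = fun q => 2 * (q i - p i) := by
  ext q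
  simp only [norm_sq_plane, PiLp.sub_apply]
  simp only [sq]
  have hd : ∀ j : Fin 2, DifferentiableAt ℝ (fun z : Plane => z j - p j) q := fun j => by fun_prop
  have hD : ∀ j : Fin 2, partialD i (fun z : Plane => z j - p j) q = if i = j then 1 else 0 :=
    fun j => by
      rw [partialD_fun_sub (by fun_prop) (by fun_prop), partialD_coord]
      simp [partialD]
  rw [partialD_fun_add ((hd 0).fun_mul (hd 0)) ((hd 1).fun_mul (hd 1)), partialD_fun_mul (hd 0) (hd 0),
    partialD_fun_mul (hd 1) (hd 1), hD, hD]
  fin_cases i <;> simp <;> ring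

theorem partialD_partialD_norm_sub_sq (i : Fin 2) (p q : Plane) :
    partialD i (partialD i fun z => ‖z - p‖ ^ 2) q = 2 := by
  rw [partialD_norm_sub_sq, partialD_const_mul (by fun_prop),
    partialD_fun_sub (by fun_prop) (by fun_prop), partialD_coord]
  simp [partialD]

theorem partialD_partialD_coord (i j k : Fin 2) (q : Plane) :
    partialD i (partialD j fun z => z k) q = 0 := by
  have : partialD j (fun z => z k) = fun _ => if j = k then 1 else 0 :=
    funext fun q => partialD_coord j k q
  rw [this]
  simp [partialD]

/-- The trace of the Hessian of `u` at a point where a quadratic comparison function touches `u`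
from above. -/
theorem trace_le_of_isLocalMin {u : Plane → ℝ} {p q : Plane} {c δ : ℝ} (hu : ContDiffAt ℝ 2 u q)
    (h : IsLocalMin (fun z => (-1) * u z + c / 4 * ‖z - p‖ ^ 2 + δ * z 0) q) :
    partialD 0 (partialD 0 u) q + partialD 1 (partialD 1 u) q ≤ c := by
  have hN : ContDiffAt ℝ 2 (fun z : Plane => ‖z - p‖ ^ 2) q := by
    have := (contDiff_norm_sq ℝ (E := Plane) (n := 2)).comp (contDiff_id.sub (contDiff_const (c := p)))
    exact this.contDiffAt
  have hz : ContDiffAt ℝ 2 (fun z : Plane => z 0) q := by fun_prop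
  have hf : ContDiffAt ℝ 2 (fun z => (-1) * u z + c / 4 * ‖z - p‖ ^ 2 + δ * z 0) q :=
    ((contDiffAt_const.mul hu).add (contDiffAt_const.mul hN)).add (contDiffAt_const.mul hz)
  have key : ∀ i, partialD i (partialD i u) q ≤ c / 2 := fun i => by
    have : 0 ≤ partialD i (partialD i fun z => (-1) * u z + c / 4 * ‖z - p‖ ^ 2 + δ * z 0) q :=
      h.fderiv_fderiv_nonneg hf _
    rw [partialD_partialD_add_add hu hN hz, partialD_partialD_norm_sub_sq,
      partialD_partialD_coord] at this
    linarith
  linarith [key 0, key 1]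

/-- Convexity spreads flatness from the axes to a small circle, where `w = -u + c/4 |z - p|² + δ
z_0` exceeds `w p`. So `w` has an interior minimum `m`: if `m ≠ p`, then `Δu ≤ c` at `m`; if `m =
p`, the tilt `δ ≠ 0` contradicts `∇u = 0`. -/
theorem not_flat_of_laplacian_lower_bound {u : Plane → ℝ} {p : Plane} {c : ℝ} (hc : 0 < c)
    (hd : ∀ᶠ q in 𝓝 p, DifferentiableAt ℝ u q) (h0 : ∀ i, partialD i u p = 0)
    (hsm : ∀ᶠ q in 𝓝[≠] p, ContDiffAt ℝ 2 u q)
    (hH : ∀ᶠ q in 𝓝[≠] p, ∀ v, 0 ≤ fderiv ℝ (fun z => fderiv ℝ u z v) q v)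
    (hΔ : ∀ᶠ q in 𝓝[≠] p, c < partialD 0 (partialD 0 u) q + partialD 1 (partialD 1 u) q)
    (hflat : ∀ i, ∀ ε > 0, ∀ᶠ t in 𝓝 (0 : ℝ),
      |u (p + t • EuclideanSpace.single i 1) - u p| ≤ ε * t ^ 2) : False := by
  rw [eventually_nhdsWithin_iff] at hsm hH hΔ
  obtain ⟨ρ, hρ, hball⟩ := Metric.eventually_nhds_iff_ball.1 (hd.and (hsm.and (hH.and hΔ)))
  obtain ⟨η, hη, hax⟩ := Metric.eventually_nhds_iff_ball.1
    ((hflat 0 (c / 32) (by positivity)).and (hflat 1 (c / 32) (by positivity)))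
  obtain ⟨R, hR, hRρ, hRη⟩ : ∃ R : ℝ, 0 < R ∧ 2 * R < ρ ∧ 2 * R < η :=
    ⟨min ρ η / 3, by positivity, by linarith [min_le_left ρ η], by linarith [min_le_right ρ η]⟩
  -- On the circle of radius `R`, `u - u p ≤ c R² / 16` (from `c / 32` at doubled arguments,
  -- averaged) and the tilt changes `w` by at most `c R² / 16`, against a gain of `c R² / 4`.
  set δ : ℝ := -(c * R / 16) with hδ
  set w : Plane → ℝ := fun z => (-1) * u z + c / 4 * ‖z - p‖ ^ 2 + δ * z 0 with hw
  have hcb : Metric.closedBall p R ⊆ Metric.ball p ρ := Metric.closedBall_subset_ball (by linarith)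
  have hwc : ContinuousOn w (Metric.closedBall p R) := by
    intro q hq
    have := (hball q (hcb hq)).1.continuousAt
    exact ContinuousAt.continuousWithinAt (by fun_prop)
  obtain ⟨m, hm, hmin⟩ := (isCompact_closedBall p R).exists_isMinOn
    ⟨p, Metric.mem_closedBall_self hR.le⟩ hwc
  have hsphere : ∀ q, ‖q - p‖ = R → w p < w q := by
    intro q hq
    set z := q - p with hz
    have hq' : q = p + z := by simp [hz]
    have hz2 : z 0 ^ 2 + z 1 ^ 2 = R ^ 2 := by rw [← norm_sq_plane, hq]
    have hz0 : |z 0| ≤ R := abs_le_of_sq_le_sq (by nlinarith [sq_nonneg (z 1)]) hR.le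
    have hz1 : |z 1| ≤ R := abs_le_of_sq_le_sq (by nlinarith [sq_nonneg (z 0)]) hR.le
    have hmem : ∀ i (t : ℝ), |t| ≤ R → p + (2 * t) • EuclideanSpace.single i 1 ∈ Metric.ball p ρ := by
      intro i t ht
      simp only [Metric.mem_ball, dist_self_add_left, norm_smul, PiLp.norm_single,
        Real.norm_eq_abs, abs_mul]
      norm_num
      linarith
    have hmemη : ∀ t : ℝ, |t| ≤ R → 2 * t ∈ Metric.ball (0 : ℝ) η := by
      intro t ht
      simp only [Metric.mem_ball, dist_zero_right, Real.norm_eq_abs, abs_mul]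
      norm_num
      linarith
    -- `q` is the midpoint of the two axis points at doubled coordinates; their open segment meets
    -- `p` only if `z = 0`.
    have hmid := midpoint_le_of_hessian_nonneg (u := u) (p := p) (ρ := ρ)
      (fun q hq => (hball q hq).1.continuousAt) (fun q hq => (hball q hq).2.1)
      (fun q hq => (hball q hq).2.2.1) (hmem 0 (z 0) hz0) (hmem 1 (z 1) hz1) (by
        rintro t ⟨ht0, ht1⟩ heq
        have e0 := congrArg (fun y : Plane => y 0) heq
        have e1 := congrArg (fun y : Plane => y 1) heq
        simp at e0 e1
        have f0 : z 0 = 0 := by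
          have : (1 - t) * z 0 = 0 := by linarith
          exact (mul_eq_zero.1 this).resolve_left (by linarith)
        have f1 : z 1 = 0 := e1.resolve_left ht0.ne'
        rw [f0, f1] at hz2
        nlinarith)
    have hpt : p + (2 * z 0) • EuclideanSpace.single 0 1 + (1 / 2 : ℝ) •
        (p + (2 * z 1) • EuclideanSpace.single 1 1 - (p + (2 * z 0) • EuclideanSpace.single 0 1)) =
        q := by
      rw [hq']
      ext i
      fin_cases i <;> simp <;> ring
    rw [hpt] at hmid
    have g0 := (abs_le.1 (hax _ (hmemη _ hz0)).1).2
    have g1 := (abs_le.1 (hax _ (hmemη _ hz1)).2).2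
    have hz0' := (abs_le.1 hz0).2
    have hq0 : q 0 = p 0 + z 0 := by rw [hq']; simp
    simp only [hw, sub_self, norm_zero, ← hz, hq, hq0, hδ]
    have e1 : c * R * z 0 ≤ c * R * R := by gcongr
    have e2 : 0 < c * R ^ 2 := by positivity
    nlinarith
  have hmne : ‖m - p‖ ≠ R := fun h =>
    absurd (hmin (Metric.mem_closedBall_self hR.le)) (not_le.2 (hsphere m h))
  have hmb : m ∈ Metric.ball p R := by
    rw [mem_closedBall_iff_norm] at hm
    rw [mem_ball_iff_norm]
    exact lt_of_le_of_ne hm hmne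
  have hloc : IsLocalMin w m :=
    hmin.isLocalMin (Filter.mem_of_superset (Metric.isOpen_ball.mem_nhds hmb)
      Metric.ball_subset_closedBall)
  by_cases hmp : m = p
  · subst hmp
    have h1 : partialD 0 w m = 0 := by rw [partialD, hloc.fderiv_eq_zero]; rfl
    have h2 := (hball m (Metric.mem_ball_self hρ)).1
    have hN : DifferentiableAt ℝ (fun z : Plane => ‖z - m‖ ^ 2) m := by
      have := (contDiff_norm_sq ℝ (E := Plane) (n := 1)).comp
        (contDiff_id.sub (contDiff_const (c := m)))
      exact (this.differentiable (by simp)) m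
    rw [hw, partialD_fun_add (by fun_prop) (by fun_prop),
      partialD_fun_add (by fun_prop) (by fun_prop), partialD_const_mul h2, h0,
      partialD_const_mul hN, partialD_norm_sub_sq, partialD_const_mul (by fun_prop),
      partialD_coord] at h1
    simp [hδ, hc.ne', hR.ne'] at h1
  · obtain ⟨-, h1, -, h3⟩ := hball m (hcb hm)
    exact absurd (trace_le_of_isLocalMin (h1 hmp) hloc) (not_le.2 (h3 hmp))

end MaximumPrinciple

/-! ### Regularity of graphs at critical points. -/

section Graph

theorem laplacian_eq_partialD {u : Plane → ℝ} {q : Plane} (hu : ContDiffAt ℝ 2 u q) :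
    Laplacian.laplacian u q = partialD 0 (partialD 0 u) q + partialD 1 (partialD 1 u) q := by
  rw [InnerProductSpace.laplacian_eq_iteratedFDeriv_orthonormalBasis u
    (EuclideanSpace.basisFun (Fin 2) ℝ), partialD_partialD hu, partialD_partialD hu]
  simp [Fin.sum_univ_two, iteratedFDeriv_two_apply]

theorem fderiv_fderiv_nonneg_of_det_pos {u : Plane → ℝ} {q : Plane} {c : ℝ} (hc : 0 < c)
    (hu : ContDiffAt ℝ 2 u q)
    (hdet : 0 < partialD 0 (partialD 0 u) q * partialD 1 (partialD 1 u) q -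
      partialD 0 (partialD 1 u) q ^ 2)
    (htr : c < partialD 0 (partialD 0 u) q + partialD 1 (partialD 1 u) q) (v : Plane) :
    0 ≤ fderiv ℝ (fun z => fderiv ℝ u z v) q v := by
  rw [fderiv_fderiv_apply_self hu]
  set A := partialD 0 (partialD 0 u) q
  set B := partialD 0 (partialD 1 u) q
  set C := partialD 1 (partialD 1 u) q
  have hA : 0 < A := by
    by_contra! hA
    nlinarith [sq_nonneg B, mul_nonneg_of_nonpos_of_nonpos hA hA]
  have h : 0 ≤ A * (v 0 ^ 2 * A + 2 * v 0 * v 1 * B + v 1 ^ 2 * C) := by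
    have : A * (v 0 ^ 2 * A + 2 * v 0 * v 1 * B + v 1 ^ 2 * C) =
      (v 0 * A + v 1 * B) ^ 2 + v 1 ^ 2 * (A * C - B ^ 2) := by ring
    rw [this]
    positivity
  exact nonneg_of_mul_nonneg_right h hA

theorem partialD_const_add {f : Plane → ℝ} (c : ℝ) (i : Fin 2) :
    partialD i (fun q => c + f q) = partialD i f := by
  ext q
  simp [partialD]

/-- Polarisation: `a i ²`, `a j ²` and `(a i + a j)²` are minimal at `p`. The `a i` themselves need
not be differentiable. -/
theorem partialD_mul_eq_zero {a : Fin 2 → Plane → ℝ} {p : Plane}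
    (hF : ∀ i j, DifferentiableAt ℝ (fun q => a i q * a j q) p) (h0 : ∀ i, a i p = 0)
    (i j k : Fin 2) : partialD k (fun q => a i q * a j q) p = 0 := by
  have hsq : ∀ i, partialD k (fun q => a i q * a i q) p = 0 := fun i => by
    have : IsLocalMin (fun q => a i q * a i q) p := Eventually.of_forall fun q => by
      simpa [h0] using mul_self_nonneg (a i q)
    rw [partialD, this.fderiv_eq_zero]; rfl
  have hmin : IsLocalMin (fun q => a i q * a i q + 2 * (a i q * a j q) + a j q * a j q) p :=
    Eventually.of_forall fun q => by
      simp only [h0]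
      nlinarith [sq_nonneg (a i q + a j q)]
  have : partialD k (fun q => a i q * a i q + 2 * (a i q * a j q) + a j q * a j q) p = 0 := by
    rw [partialD, hmin.fderiv_eq_zero]; rfl
  have hij := hF i j
  have hii := hF i i
  have hjj := hF j j
  rw [partialD_fun_add (by fun_prop) hjj, partialD_fun_add hii (by fun_prop), hsq, hsq,
    partialD_const_mul hij] at this
  linarith

variable {g : Plane → Matrix (Fin 2) (Fin 2) ℝ} {u : Plane → ℝ} {p : Plane}

/-- Regularity of a graph at an isolated critical point, around which it is smooth and has positive
Gauss curvature. -/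
theorem contDiffAt_partialD_of_gaussCurvature_pos
    (hg : ∀ᶠ q in 𝓝 p, ∀ i j,
      g q i j = (if i = j then 1 else 0) + partialD i u q * partialD j u q)
    (hc : ∀ i, ∀ᶠ q in 𝓝 p, ContinuousAt (partialD i u) q)
    (hF : ∀ i j, ContDiffAt ℝ ∞ (fun q => partialD i u q * partialD j u q) p)
    (h0 : ∀ i, partialD i u p = 0) (hsm : ∀ᶠ q in 𝓝[≠] p, ContDiffAt ℝ ∞ u q)
    (hK : ∀ᶠ q in 𝓝[≠] p, 0 < gaussCurvature g q)
    -- An implication, because at the origin nondegeneracy is itself deduced from convexity off the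
    -- point.
    (hnd : (∀ᶠ q in 𝓝[≠] p, 0 < partialD 0 (partialD 0 u) q * partialD 1 (partialD 1 u) q -
        partialD 0 (partialD 1 u) q ^ 2) →
      ∃ i, partialD i (partialD i fun q => partialD i u q * partialD i u q) p ≠ 0) :
    ∀ i, ContDiffAt ℝ ∞ (partialD i u) p := by
  have hdet : ∀ᶠ q in 𝓝[≠] p, 0 < partialD 0 (partialD 0 u) q * partialD 1 (partialD 1 u) q -
      partialD 0 (partialD 1 u) q ^ 2 := by
    filter_upwards [hsm, hK, eventually_nhdsWithin_of_eventually_nhds hg.eventually_nhds]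
      with q h1 h2 h3
    have h4 : ContDiffAt ℝ ((3 : ℕ) : WithTop ℕ∞) u q := contDiffAt_infty.1 h1 3
    rw [gaussCurvature_of_graph (by exact_mod_cast h4) h3] at h2
    exact (div_pos_iff_of_pos_right (by positivity)).1 h2
  exact contDiffAt_partialD_of_critical hc hF h0 hsm hdet (hnd hdet)

theorem contDiffAt_two_of_infty {f : Plane → ℝ} {q : Plane} (h : ContDiffAt ℝ ∞ f q) :
    ContDiffAt ℝ 2 f q := by
  have : ContDiffAt ℝ ((2 : ℕ) : WithTop ℕ∞) f q := contDiffAt_infty.1 h 2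
  exact_mod_cast this

/-- The regularity at a critical point of positive curvature. -/
theorem contDiffAt_partialD_of_gaussCurvature_pos_at
    (hg : ∀ᶠ q in 𝓝 p, ∀ i j,
      g q i j = (if i = j then 1 else 0) + partialD i u q * partialD j u q)
    (hd : ∀ᶠ q in 𝓝 p, DifferentiableAt ℝ u q)
    (hc : ∀ i, ∀ᶠ q in 𝓝 p, ContinuousAt (partialD i u) q)
    (hF : ∀ᶠ q in 𝓝 p, ∀ i j, ContDiffAt ℝ ∞ (fun q => partialD i u q * partialD j u q) q)
    (h0 : ∀ i, partialD i u p = 0) (hK : ∀ᶠ q in 𝓝 p, 0 < gaussCurvature g q) :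
    ∀ i, ContDiffAt ℝ ∞ (partialD i u) p := by
  have hFp := hF.self_of_nhds
  have hF2 : ∀ i j, ContDiffAt ℝ 2 (fun q => partialD i u q * partialD j u q) p := fun i j =>
    contDiffAt_two_of_infty (hFp i j)
  have hgF : ∀ i j, (fun q => g q i j) =ᶠ[𝓝 p]
      fun q => (if i = j then 1 else 0) + partialD i u q * partialD j u q := fun i j =>
    hg.mono fun q hq => hq i j
  have hgp : g p = 1 := by
    ext i j
    rw [hg.self_of_nhds, h0, zero_mul, add_zero, Matrix.one_apply]
  have hgD : ∀ i j k, partialD k (fun q => g q i j) =ᶠ[𝓝 p]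
      partialD k fun q => partialD i u q * partialD j u q := fun i j k =>
    (partialD_eventuallyEq (hgF i j) k).trans (by rw [partialD_const_add])
  have hcrit := gaussCurvature_of_critical (g := g) (p := p)
    (fun i j => (contDiffAt_const.add (hF2 i j)).congr_of_eventuallyEq (hgF i j))
    (hg.mono fun q hq => by rw [hq, hq]; simp [mul_comm]) hgp
    (fun i j k => by
      rw [(hgD i j k).self_of_nhds]
      exact partialD_mul_eq_zero (fun i j => (hF2 i j).differentiableAt (by simp)) h0 i j k)
  rw [partialD_congr (hgD 0 1 1), partialD_congr (hgD 1 1 0), partialD_congr (hgD 0 0 1)] at hcrit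
  have hneg : partialD 1 (partialD 1 fun q => partialD 0 u q * partialD 0 u q) p +
      partialD 0 (partialD 0 fun q => partialD 1 u q * partialD 1 u q) p -
      2 * partialD 0 (partialD 1 fun q => partialD 0 u q * partialD 1 u q) p < 0 := by
    have := hK.self_of_nhds
    rw [hcrit] at this
    linarith
  have hiso := eventually_exists_ne_zero (a := fun i => partialD i u) hF2 h0 hneg
  have hreg : ∀ᶠ q in 𝓝[≠] p, ContDiffAt ℝ ∞ u q := by
    have hreg' : ∀ᶠ q in 𝓝[≠] p, ∀ i, ContDiffAt ℝ ∞ (partialD i u) q := by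
      filter_upwards [hiso, eventually_nhdsWithin_of_eventually_nhds hF,
        eventually_nhdsWithin_of_eventually_nhds (hc 0),
        eventually_nhdsWithin_of_eventually_nhds (hc 1)] with q ⟨k, hk⟩ h1 h2 h3
      refine contDiffAt_of_mul_of_ne_zero (a := fun i => partialD i u) h1 ?_ hk
      fin_cases k <;> assumption
    filter_upwards [hreg', eventually_nhdsWithin_of_eventually_nhds hd.eventually_nhds] with q h1 h2
    exact contDiffAt_of_partialD h2 h1
  refine contDiffAt_partialD_of_gaussCurvature_pos hg hc hFp h0 hreg
    (eventually_nhdsWithin_of_eventually_nhds hK) fun _ => ?_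
  rcases nonneg_left_of_nonneg_forms (hessian_forms_nonneg (a := fun i => partialD i u) hF2 h0) hneg
    with h | h
  exacts [⟨0, h⟩, ⟨1, h⟩]

/-- The regularity at a critical point near which the Laplacian has a positive lower bound. -/
theorem contDiffAt_partialD_of_laplacian_lower_bound {c : ℝ} (hc0 : 0 < c)
    (hg : ∀ᶠ q in 𝓝 p, ∀ i j,
      g q i j = (if i = j then 1 else 0) + partialD i u q * partialD j u q)
    (hd : ∀ᶠ q in 𝓝 p, DifferentiableAt ℝ u q)
    (hc : ∀ i, ∀ᶠ q in 𝓝 p, ContinuousAt (partialD i u) q)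
    (hF : ∀ i j, ContDiffAt ℝ ∞ (fun q => partialD i u q * partialD j u q) p)
    (h0 : ∀ i, partialD i u p = 0) (hsm : ∀ᶠ q in 𝓝[≠] p, ContDiffAt ℝ ∞ u q)
    (hK : ∀ᶠ q in 𝓝[≠] p, 0 < gaussCurvature g q)
    (hΔ : ∀ᶠ q in 𝓝[≠] p, c < Laplacian.laplacian u q) :
    ∀ i, ContDiffAt ℝ ∞ (partialD i u) p := by
  refine contDiffAt_partialD_of_gaussCurvature_pos hg hc hF h0 hsm hK fun hdet => ?_
  by_contra! hcon
  have hsm2 : ∀ᶠ q in 𝓝[≠] p, ContDiffAt ℝ 2 u q := hsm.mono fun q hq => contDiffAt_two_of_infty hq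
  have htr : ∀ᶠ q in 𝓝[≠] p, c < partialD 0 (partialD 0 u) q + partialD 1 (partialD 1 u) q := by
    filter_upwards [hΔ, hsm2] with q h1 h2
    rwa [← laplacian_eq_partialD h2]
  refine not_flat_of_laplacian_lower_bound hc0 hd h0 hsm2 ?_ htr fun i ε hε =>
    abs_sub_le_mul_sq_of_degenerate hd (contDiffAt_two_of_infty (hF i i)) (h0 i) (hcon i) hε
  filter_upwards [hdet, hsm2, htr] with q h1 h2 h3
  exact fderiv_fderiv_nonneg_of_det_pos hc0 h2 h1 h3

end Graph

/-! ### The main theorem. -/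

theorem corollary1p2 (r : ℝ) (hr : 0 < r)
    (g : Plane → Matrix (Fin 2) (Fin 2) ℝ)
    (hg : IsRiemannianMetricOn ∞ g (Metric.ball 0 r))
    (hK : ∀ p ∈ Metric.ball (0 : Plane) r, p ≠ 0 → 0 < gaussCurvature g p)
    (X : Plane → Space) (u : Plane → ℝ)
    (hX : IsC11On X (Metric.ball 0 r))
    (hiso : IsIsometricEmbeddingOn g (Metric.ball 0 r) X)
    (hgraph : ∀ p ∈ Metric.ball (0 : Plane) r, X p = !₂[p 0, p 1, u p])
    (hu : u 0 = 0) (hux : partialD 0 u 0 = 0) (huy : partialD 1 u 0 = 0)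
    (C₀ : ℝ) (hC₀ : 0 < C₀)
    (hΔ : ∀ᶠ p in nhdsWithin (0 : Plane) {0}ᶜ, C₀ < Laplacian.laplacian u p) :
    ContDiffOn ℝ ∞ X (Metric.ball 0 r) := by
  have hmem : ∀ q ∈ Metric.ball (0 : Plane) r, Metric.ball (0 : Plane) r ∈ 𝓝 q := fun q hq =>
    Metric.isOpen_ball.mem_nhds hq
  have hcoord : ∀ q ∈ Metric.ball (0 : Plane) r, ∀ k : Fin 3,
      HasFDerivAt (fun z => X z k)
        ((EuclideanSpace.proj k : Space →L[ℝ] ℝ).comp (fderiv ℝ X q)) q := fun q hq k =>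
    (EuclideanSpace.proj k : Space →L[ℝ] ℝ).hasFDerivAt.comp q
      (hX.1.differentiableAt (hmem q hq)).hasFDerivAt
  have hX2 : ∀ q ∈ Metric.ball (0 : Plane) r, (fun z => X z 2) =ᶠ[𝓝 q] u := fun q hq => by
    filter_upwards [hmem q hq] with z hz
    rw [hgraph z hz]; rfl
  have hud : ∀ q ∈ Metric.ball (0 : Plane) r, DifferentiableAt ℝ u q := fun q hq =>
    ((hcoord q hq 2).differentiableAt).congr_of_eventuallyEq (hX2 q hq).symm
  have hpart : ∀ q ∈ Metric.ball (0 : Plane) r, ∀ i,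
      partialD i u q = fderiv ℝ X q (EuclideanSpace.single i 1) 2 := fun q hq i => by
    rw [← partialD_congr (hX2 q hq) i, partialD, (hcoord q hq 2).fderiv]; rfl
  have hpart' : ∀ q ∈ Metric.ball (0 : Plane) r, ∀ (i : Fin 2) (k : Fin 2),
      fderiv ℝ X q (EuclideanSpace.single i 1) k.castSucc = if i = k then 1 else 0 :=
    fun q hq i k => by
      have h1 : (fun z => X z k.castSucc) =ᶠ[𝓝 q] fun z => z k := by
        filter_upwards [hmem q hq] with z hz
        rw [hgraph z hz]
        fin_cases k <;> rfl
      rw [← partialD_coord i k q, ← partialD_congr h1 i, partialD, (hcoord q hq k.castSucc).fderiv]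
      rfl
  have hmetric : ∀ q ∈ Metric.ball (0 : Plane) r, ∀ i j,
      g q i j = (if i = j then 1 else 0) + partialD i u q * partialD j u q := fun q hq i j => by
    have h1 := hiso.pullback q hq (EuclideanSpace.single i 1) (EuclideanSpace.single j 1)
    have h2 : (∑ k, ∑ l, g q k l * (EuclideanSpace.single i 1 : Plane) k *
        (EuclideanSpace.single j 1 : Plane) l) = g q i j := by
      simp
    rw [h2] at h1
    have a0 := hpart' q hq i 0
    have a1 := hpart' q hq i 1
    have b0 := hpart' q hq j 0
    have b1 := hpart' q hq j 1
    simp only [Fin.castSucc_zero, Fin.castSucc_one] at a0 a1 b0 b1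
    rw [← h1, PiLp.inner_apply, Fin.sum_univ_three, hpart q hq i, hpart q hq j, a0, a1, b0, b1]
    fin_cases i <;> fin_cases j <;> simp [mul_comm, sq]
  have hcont : ∀ q ∈ Metric.ball (0 : Plane) r, ∀ i, ContinuousAt (partialD i u) q :=
    fun q hq i => by
      have h1 : ContinuousAt (fderiv ℝ X) q := hX.2.continuousOn.continuousAt (hmem q hq)
      have h2 : ContinuousAt (fun z => fderiv ℝ X z (EuclideanSpace.single i 1) 2) q := by fun_prop
      refine h2.congr ?_
      filter_upwards [hmem q hq] with z hz using (hpart z hz i).symm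
  have hF : ∀ q ∈ Metric.ball (0 : Plane) r, ∀ i j,
      ContDiffAt ℝ ∞ (fun q => partialD i u q * partialD j u q) q := fun q hq i j => by
    have h1 : ContDiffAt ℝ ∞ (fun z => g z i j - if i = j then 1 else 0) q :=
      ((hg.contDiffOn i j).contDiffAt (hmem q hq)).sub contDiffAt_const
    refine h1.congr_of_eventuallyEq ?_
    filter_upwards [hmem q hq] with z hz
    rw [hmetric z hz]; ring
  -- This comes before the origin, whose argument needs `u` smooth on a punctured neighbourhood.
  have hoff : ∀ q ∈ Metric.ball (0 : Plane) r, q ≠ 0 → ∀ i, ContDiffAt ℝ ∞ (partialD i u) q := by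
    intro q hq hq0
    by_cases hcrit : ∃ k, partialD k u q ≠ 0
    · obtain ⟨k, hk⟩ := hcrit
      exact contDiffAt_of_mul_of_ne_zero (a := fun i => partialD i u) (hF q hq) (hcont q hq k) hk
    · push Not at hcrit
      exact contDiffAt_partialD_of_gaussCurvature_pos_at (eventually_of_mem (hmem q hq) hmetric)
        (eventually_of_mem (hmem q hq) hud)
        (fun i => eventually_of_mem (hmem q hq) fun z hz => hcont z hz i)
        (eventually_of_mem (hmem q hq) hF) hcrit
        (by filter_upwards [hmem q hq, isOpen_ne.mem_nhds hq0] with z hz hz0 using hK z hz hz0)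
  have hu_of : ∀ q ∈ Metric.ball (0 : Plane) r, (∀ i, ContDiffAt ℝ ∞ (partialD i u) q) →
      ContDiffAt ℝ ∞ u q := fun q hq h =>
    contDiffAt_of_partialD (eventually_of_mem (hmem q hq) hud) h
  have h0mem : (0 : Plane) ∈ Metric.ball (0 : Plane) r := Metric.mem_ball_self hr
  have hpunct : ∀ᶠ q in 𝓝[≠] (0 : Plane), q ∈ Metric.ball (0 : Plane) r ∧ q ≠ 0 :=
    (eventually_nhdsWithin_of_eventually_nhds (hmem 0 h0mem)).and eventually_mem_nhdsWithin
  have hzero : ∀ i, ContDiffAt ℝ ∞ (partialD i u) 0 :=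
    contDiffAt_partialD_of_laplacian_lower_bound hC₀ (eventually_of_mem (hmem 0 h0mem) hmetric)
      (eventually_of_mem (hmem 0 h0mem) hud)
      (fun i => eventually_of_mem (hmem 0 h0mem) fun z hz => hcont z hz i) (hF 0 h0mem)
      (fun i => by fin_cases i <;> assumption)
      (hpunct.mono fun q hq => hu_of q hq.1 (hoff q hq.1 hq.2))
      (hpunct.mono fun q hq => hK q hq.1 hq.2) hΔ
  intro q hq
  have huq : ContDiffAt ℝ ∞ u q := hu_of q hq (by
    by_cases hq0 : q = 0
    · exact hq0 ▸ hzero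
    · exact hoff q hq hq0)
  refine ContDiffAt.contDiffWithinAt ?_
  rw [contDiffAt_euclidean]
  intro k
  fin_cases k
  · refine (by fun_prop : ContDiffAt ℝ ∞ (fun z : Plane => z 0) q).congr_of_eventuallyEq ?_
    filter_upwards [hmem q hq] with z hz
    rw [hgraph z hz]; rfl
  · refine (by fun_prop : ContDiffAt ℝ ∞ (fun z : Plane => z 1) q).congr_of_eventuallyEq ?_
    filter_upwards [hmem q hq] with z hz
    rw [hgraph z hz]; rfl
  · exact huq.congr_of_eventuallyEq (hX2 q hq)
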